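/- Let $\alpha,\beta\in(0,1)$, let $n\ge 1$, and let $X_1,\dots,X_n$ be a stationary Markov chain with state space $\{0,1\}$ and transition matrix $$\begin{pmatrix} p_{00} & p_{01}\\ p_{10} & p_{11}\end{pmatrix}=\begin{pmatrix}1-\alpha&\alpha\\ 1-\beta&\beta\end{pmatrix}.$$ Let $S=\sum_{i=1}^n X_i$, with law $\mathcal L(S)$, and let $p=\frac{\alpha}{1-\beta+\alpha}$ be the stationary probability of the state $1$. Write $\alpha\vee\beta=\max(\alpha,\beta)$. For probability distributions $P,Q$ on $\mathbb Z_+=\{0,1,2,\dots\}$ let $d_{TV}(P,Q)=\sup_{A\subset\mathbb Z_+}|P(A)-Q(A)|$. For $r>0$ and $0<q<1$ let $\mathrm{NB}(r,q)$ be the distribution with mass $\frac{\Gamma(r+k)}{\Gamma(r)\,k!}q^r(1-q)^k$ at $k\in\mathbb Z_+$, and let $\mathrm{Bi}(m,\theta)$ be the binomial distribution. Put $$\mu_1=\frac{1-\alpha}{\alpha},\quad \sigma_1^2=\frac{1-\alpha}{\alpha^2},\quad \mu_2=\frac{\beta}{1-\beta},\quad \sigma_2^2=\frac{\beta}{(1-\beta)^2},$$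 $$C_0=\frac{|\beta-\alpha|\,(5+43(\alpha\vee\beta))}{(1-\alpha\vee\beta)^2},\quad C_1=\frac{10(\alpha\vee\beta)}{1-\alpha\vee\beta},\quad C_2=\frac{(1-p)(5+23(\alpha\vee\beta))}{(1-\alpha\vee\beta)^2},$$ $$K_1=\sqrt5\,\sqrt{\frac{\mu_1+\mu_2+2}{\min(1-\alpha,\beta,1/2)}},\qquad K_2=\frac{90(\sigma_1^2+\sigma_2^2)}{\mu_1+\mu_2+2}.$$ 1. If $\operatorname{Var}S\ge \mathbb ES$, then, with $r=\frac{(\mathbb ES)^2}{\operatorname{Var}S-\mathbb ES}$ and $q=\frac{\mathbb ES}{\operatorname{Var}S}$, $$d_{TV}(\mathcal L(S),\mathrm{NB}(r,q))\le C_0\left[\frac{2K_1}{\sqrt n}+\frac{4K_2}{n}+\beta^{\lfloor n/4\rfloor}\right],$$ where, if $\operatorname{Var}S=\mathbb ES$, $\mathrm{NB}(\infty,1)$ is understood as the Poisson distribution with mean $\mathbb ES$. 2. If $\operatorname{Var}S<\mathbb ES$, let $\tilde m=\frac{(\mathbb ES)^2}{\mathbb ES-\operatorname{Var}S}$, $m=\lfloor\tilde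 m\rfloor$ and $\theta=\frac{np}{m}$. If $\theta<1$, then $$d_{TV}(\mathcal L(S),\mathrm{Bi}(m,\theta))\le\left(\frac{|p-\theta|}{1-\theta}C_1+\frac{|\beta-\alpha|}{1-\theta}C_2\right)\left[\frac{2K_1}{\sqrt n}+\frac{4K_2}{n}+(\alpha\vee\beta)^{\lfloor n/4\rfloor}\right]+\frac{\theta^2(\tilde m-m)}{np(1-\theta)}.$$ (One always has $\tilde m\ge1$, so that $m\ge1$ and $\theta>0$.) -/

import Mathlib

open MeasureTheory ProbabilityTheory

noncomputable section

namespace MarkovBinomial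

/-- The transition matrix of the two-state chain on `{0, 1}`: `p₀₁ = α`, `p₁₁ = β`. -/
def transitionMatrix (α β : ℝ) : Matrix (Fin 2) (Fin 2) ℝ :=
  !![1 - α, α; 1 - β, β]

/-- `X 1, …, X n` is, under `μ`, a stationary Markov chain on `{0, 1}` with transition matrix `P`.
The values of `X` at indices outside `{1, …, n}` play no role. -/
structure IsStationaryMarkovChain {Ω : Type*} [MeasurableSpace Ω] (μ : Measure Ω)
    (P : Matrix (Fin 2) (Fin 2) ℝ) (n : ℕ) (X : ℕ → Ω → Fin 2) : Prop where
  /-- The `X i` are random variables. -/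
  measurable : ∀ i ∈ Finset.Icc 1 n, Measurable (X i)
  /-- The Markov property
  `ℙ(X_{k+1} = x_{k+1} | X_1 = x_1, …, X_k = x_k) = P(x_k, x_{k+1})` for `1 ≤ k < n`,
  multiplied by the probability of the conditioning event. -/
  markov : ∀ k : ℕ, 1 ≤ k → k < n → ∀ x : ℕ → Fin 2,
    μ.real {ω | ∀ i ∈ Finset.Icc 1 (k + 1), X i ω = x i} =
      μ.real {ω | ∀ i ∈ Finset.Icc 1 k, X i ω = x i} * P (x k) (x (k + 1))
  /-- The initial law is invariant: `π P = π`. -/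
  stationary : Matrix.vecMul (fun j => μ.real {ω | X 1 ω = j}) P =
    fun j => μ.real {ω | X 1 ω = j}

/-- `S = X 1 + ⋯ + X n`, with values in `ℕ`. -/
def chainSum {Ω : Type*} (n : ℕ) (X : ℕ → Ω → Fin 2) (ω : Ω) : ℕ :=
  ∑ i ∈ Finset.Icc 1 n, (X i ω : ℕ)

/-- The total variation distance `sup_{A ⊆ ℤ₊} |P(A) - Q(A)|` of two probability measures. -/
def dTV (P Q : Measure ℕ) : ℝ :=
  ⨆ A : Set ℕ, |P.real A - Q.real A|

/-- The negative binomial distribution `NB(r, q)`, for `r > 0` and `0 < q < 1`. -/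
def negBinomial (r q : ℝ) : Measure ℕ :=
  Measure.sum fun k : ℕ =>
    ENNReal.ofReal
      (Real.Gamma (r + k) / (Real.Gamma r * (k.factorial : ℝ)) * q ^ r * (1 - q) ^ k) •
      Measure.dirac k

/-- The stationary probability of the state `1`. -/
def p (α β : ℝ) : ℝ := α / (1 - β + α)

def μ₁ (α : ℝ) : ℝ := (1 - α) / α

def μ₂ (β : ℝ) : ℝ := β / (1 - β)

/-- The variance `σ₁²`. -/
def σ₁sq (α : ℝ) : ℝ := (1 - α) / α ^ 2

/-- The variance `σ₂²`. -/
def σ₂sq (β : ℝ) : ℝ := β / (1 - β) ^ 2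

def C₀ (α β : ℝ) : ℝ := |β - α| * (5 + 43 * max α β) / (1 - max α β) ^ 2

def C₁ (α β : ℝ) : ℝ := 10 * max α β / (1 - max α β)

def C₂ (α β : ℝ) : ℝ := (1 - p α β) * (5 + 23 * max α β) / (1 - max α β) ^ 2

def K₁ (α β : ℝ) : ℝ :=
  √5 * √((μ₁ α + μ₂ β + 2) / min (1 - α) (min β (1 / 2)))

def K₂ (α β : ℝ) : ℝ :=
  90 * (σ₁sq α + σ₂sq β) / (μ₁ α + μ₂ β + 2)

end MarkovBinomial

end

/-!
The proof is Stein's method with a birth–death operator. Negative binomial, Poisson and binomial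
laws are the stationary laws of the chains on `ℕ` with birth rates `a + b k` and death rates `k`,
with `0 < b < 1`, `b = 0` and `b < 0` respectively. For a test set `A`, the solution `g` of the
Stein equation `(a + b k) g (k + 1) - k g k = 1_A k - Q A` (`steinSol`) has increments bounded by
the smaller of the inverses of the two rates (`abs_steinSol_sub_le`), so the distance is
controlled by `E[(a + b S) g (S + 1) - S g S]` for functions `g` with bounded increments.

This expectation is a linear functional of the generating function `F` of `S`, on which the
operator acts as `X (a F + b X F' - F')`. Since a two-state chain is reversible, conditioning on
the state at one time factors `F` into generating functions of past and future (`genStat_split`),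
and `F'` is a sum over the position of a visit to `1` of such products started from the state `1`
(`derivative_genStat`). If `a = (1 - b) E[S]`, the difference is `X - 1` times an explicit
polynomial `steinRemainder` (`polyEval_stein_genStat`), so that only increments of `g` enter.
Taking `g k = k` shows that the value of this polynomial at `X = 1` is `E[S] - (1 - b) Var S`
(`IsStationaryMarkovChain.mean_variance`), which is zero when the variances match.

When the value at `1` is subtracted off, each term of the polynomial contains a further factor
`X - 1` and a factor `β - α` (`defect_eq`), multiplied by products of generating functions of two
pieces of the chain, at least one of which is long. Multiplication by `X - 1` makes the generating
function of a long piece small, of order `1 / √n`: two steps of the chain contain, with a fixed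
probability and independently of everything else, the toss of a fair coin (`norm_two_steps_le`),
and a sum of `N` fair coins is changed by its unit shift by at most `1 / √N` in total variation
(`norm_sub_one_mul_one_add_pow_le`). The smallness is measured in the operator norm of polynomials
acting by the shift on bounded functions. The result is `norm_defect_le`.

In the binomial case the parameter `m` has to be an integer, so only the means match; the
difference of the variances gives the last term of the bound, and the Stein solution needs care
beyond `m` (`IsStationaryMarkovChain.dTV_binomial_le`). The constants obtained are smaller than
those of the theorem; in particular the terms with `K₂` and `C₁` are only slack.
-/

/-! ### The Stein equation of a linear birth–death chain -/

namespace MarkovBinomial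

/-- The solution of the Stein equation `(a + b i) g (i + 1) - i g i = χ i - q`, in terms of partial
sums for weights `w`; it solves the equation at `i` as soon as `(a + b i) w i = (i + 1) w (i + 1)`,
with both weights positive. The value at `0` is the junk value `0`, which plays no role. -/
noncomputable def steinSol (w χ : ℕ → ℝ) (q : ℝ) (i : ℕ) : ℝ :=
  (∑ j ∈ Finset.range i, χ j * w j - q * ∑ j ∈ Finset.range i, w j) / (i * w i)

lemma steinSol_spec {w χ : ℕ → ℝ} {q a b : ℝ} {i : ℕ}
    (hrec : (a + b * i) * w i = (i + 1) * w (i + 1)) (hi : 0 < w i) (hi' : 0 < w (i + 1)) :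
    (a + b * i) * steinSol w χ q (i + 1) - i * steinSol w χ q i = χ i - q := by
  have h1 : (a + b * i) * steinSol w χ q (i + 1) =
      (∑ j ∈ Finset.range (i + 1), χ j * w j - q * ∑ j ∈ Finset.range (i + 1), w j) / w i := by
    unfold steinSol
    have : (0 : ℝ) < (i : ℝ) + 1 := by positivity
    push_cast
    rw [← hrec, mul_div_assoc', div_eq_div_iff ?_ hi.ne']
    · ring
    · rw [hrec]; positivity
  have h2 : i * steinSol w χ q i =
      (∑ j ∈ Finset.range i, χ j * w j - q * ∑ j ∈ Finset.range i, w j) / w i := by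
    unfold steinSol
    rcases Nat.eq_zero_or_pos i with rfl | h
    · simp
    · have : (0 : ℝ) < i := by exact_mod_cast h
      field_simp
  rw [h1, h2, Finset.sum_range_succ, Finset.sum_range_succ]
  field_simp
  ring

section Factor

variable {w χ : ℕ → ℝ} {q a b : ℝ}

/-- The lower monotonicity: the ratio of the distribution function to the death flow increases. -/
lemma birth_mul_sum_le (hb : b ≤ 1) (hw : ∀ i, 0 ≤ w i)
    (hrec : ∀ i : ℕ, (a + b * i) * w i = (i + 1) * w (i + 1)) (i : ℕ) :
    (a + b * i) * ∑ j ∈ Finset.range i, w j ≤ i * ∑ j ∈ Finset.range (i + 1), w j := by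
  induction i with
  | zero => simp
  | succ i ih =>
    have hF : 0 ≤ ∑ j ∈ Finset.range (i + 1), w j := Finset.sum_nonneg fun j _ => hw j
    have h := hrec i
    rw [Finset.sum_range_succ _ (i + 1)]
    have h3 := Finset.sum_range_succ w i
    have h4 : (a + b * i) * ∑ j ∈ Finset.range (i + 1), w j =
        (a + b * i) * ∑ j ∈ Finset.range i, w j + (i + 1) * w (i + 1) := by
      rw [h3, ← h]; ring
    have h5 := mul_nonneg (sub_nonneg.2 hb) hF
    push_cast
    linarith

/-- The upper monotonicity, compared term by term along the tail. -/
lemma mul_tail_le (ha : 0 ≤ a) (hw : ∀ i, 0 ≤ w i) (hsum : HasSum w 1)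
    (hrec : ∀ i : ℕ, (a + b * i) * w i = (i + 1) * w (i + 1)) (i : ℕ) (hai : 0 ≤ a + b * i) :
    i * (1 - ∑ j ∈ Finset.range (i + 1), w j) ≤
      (a + b * i) * (1 - ∑ j ∈ Finset.range i, w j) := by
  have h1 : HasSum (fun k => w (k + i)) (1 - ∑ j ∈ Finset.range i, w j) := by
    rw [hasSum_nat_add_iff]; simpa using hsum
  have h2 : HasSum (fun k => w (k + (i + 1))) (1 - ∑ j ∈ Finset.range (i + 1), w j) := by
    rw [hasSum_nat_add_iff]; simpa using hsum
  refine hasSum_le (fun k => ?_) (h2.mul_left (i : ℝ)) (h1.mul_left (a + b * i))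
  have h := hrec (k + i)
  push_cast at h
  have hk : (0 : ℝ) < (k : ℝ) + i + 1 := by positivity
  have : w (k + (i + 1)) = (a + b * (k + i)) * w (k + i) / (k + i + 1) := by
    rw [eq_div_iff hk.ne', h]; ring_nf
  rw [this, mul_div_assoc', div_le_iff₀ hk]
  have h0 : 0 ≤ (a * k + (a + b * i)) * w (k + i) :=
    mul_nonneg (by positivity) (hw _)
  nlinarith

/-- **Stein factor** for a birth-death chain with births `a + b i` and deaths `i`: each increment
of the solution is largest for the test set `{i}`, or for its complement. -/
lemma abs_steinSol_sub_le (ha : 0 ≤ a) (hb : b ≤ 1) (hw : ∀ i, 0 ≤ w i) (hsum : HasSum w 1)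
    (hrec : ∀ i : ℕ, (a + b * i) * w i = (i + 1) * w (i + 1))
    (hχ0 : ∀ i, 0 ≤ χ i) (hχ1 : ∀ i, χ i ≤ 1) (hq : HasSum (fun i => χ i * w i) q)
    {i : ℕ} (hi : 1 ≤ i) (hwi : 0 < w i) (hai : 0 < a + b * i) :
    |steinSol w χ q (i + 1) - steinSol w χ q i| ≤ min (a + b * i)⁻¹ (i : ℝ)⁻¹ := by
  have hi0 : (0 : ℝ) < i := by exact_mod_cast hi
  set F := ∑ j ∈ Finset.range i, w j with hF
  set L := ∑ j ∈ Finset.range i, χ j * w j with hL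
  have hF1 : ∑ j ∈ Finset.range (i + 1), w j = F + w i := Finset.sum_range_succ _ _
  have hL1 : ∑ j ∈ Finset.range (i + 1), χ j * w j = L + χ i * w i := Finset.sum_range_succ _ _
  have hφ := birth_mul_sum_le hb hw hrec i
  have hψ := mul_tail_le ha hw hsum hrec i hai.le
  rw [hF1] at hφ hψ
  have hL0 : 0 ≤ L := Finset.sum_nonneg fun j _ => mul_nonneg (hχ0 j) (hw j)
  have hLF : L ≤ F := Finset.sum_le_sum fun j _ => mul_le_of_le_one_left (hw j) (hχ1 j)
  have hF0 : 0 ≤ F := Finset.sum_nonneg fun j _ => hw j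
  -- the mass of the test set above `i`, and its comparison with the tail
  have hU1 : HasSum (fun k => χ (k + (i + 1)) * w (k + (i + 1))) (q - (L + χ i * w i)) := by
    have := (hasSum_nat_add_iff (f := fun k => χ k * w k) (i + 1) (g := q - (L + χ i * w i))).2
    apply this
    rw [hL1]; simpa using hq
  have hR1 : HasSum (fun k => w (k + (i + 1))) (1 - (F + w i)) := by
    have := (hasSum_nat_add_iff (f := w) (i + 1) (g := 1 - (F + w i))).2
    apply this
    rw [hF1]; simpa using hsum
  have hU0 : 0 ≤ q - (L + χ i * w i) := hU1.nonneg fun k => mul_nonneg (hχ0 _) (hw _)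
  have hUR : q - (L + χ i * w i) ≤ 1 - (F + w i) :=
    hasSum_le (fun k => mul_le_of_le_one_left (hw _) (hχ1 _)) hU1 hR1
  have hx0 := hχ0 i
  have hx1 := hχ1 i
  set x := χ i with hx
  set U := q - (L + x * w i) with hU
  set R := 1 - (F + w i) with hR
  set A := a + b * i with hA
  have hq' : q = U + L + x * w i := by rw [hU]; ring
  have e1 : steinSol w χ q (i + 1) = (L + x * w i - q * (F + w i)) / (A * w i) := by
    unfold steinSol
    rw [hF1, hL1, hrec i]; push_cast; rfl
  have e2 : steinSol w χ q i = (L - q * F) / (i * w i) := rfl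
  have hψ' : (i : ℝ) * R ≤ A * (R + w i) := by
    have : 1 - F = R + w i := by rw [hR]; ring
    rw [← this]; exact hψ
  have key : (i * A) * (steinSol w χ q (i + 1) - steinSol w χ q i) =
      (-(L * (A * (R + w i) - i * R)) - U * (i * (F + w i) - A * F)) / w i
        + x * (i * R + A * F) := by
    rw [e1, e2, hq']
    have : (1 : ℝ) = R + F + w i := by rw [hR]; ring
    field_simp
    linear_combination (-(i * (L + x * w i)) + A * L) * this
  -- with the whole of `ℕ` as test set the solution vanishes, which ties the two drifts together
  have tie : (F * (A * (R + w i) - i * R) + R * (i * (F + w i) - A * F)) / w i =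
      i * R + A * F := by
    field_simp; ring
  have hpos : 0 < i * A := by positivity
  have hd1 : 0 ≤ A * (R + w i) - i * R := by linarith
  have hd2 : 0 ≤ i * (F + w i) - A * F := by linarith
  have hR0 : 0 ≤ R := hU0.trans hUR
  have hδ : 0 ≤ i * R + A * F := by positivity
  have hm1 : 0 ≤ (L * (A * (R + w i) - i * R) + U * (i * (F + w i) - A * F)) / w i := by
    positivity
  have hm2 : (L * (A * (R + w i) - i * R) + U * (i * (F + w i) - A * F)) / w i ≤
      i * R + A * F := by
    rw [← tie]
    gcongr
  have habs : |(i * A) * (steinSol w χ q (i + 1) - steinSol w χ q i)| ≤ i * R + A * F := by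
    rw [key, abs_le]
    have e : (-(L * (A * (R + w i) - i * R)) - U * (i * (F + w i) - A * F)) / w i =
      -((L * (A * (R + w i) - i * R) + U * (i * (F + w i) - A * F)) / w i) := by ring
    rw [e]
    constructor
    · linarith [mul_nonneg hx0 hδ]
    · linarith [mul_le_mul_of_nonneg_right hx1 hδ]
  rw [abs_mul, abs_of_pos hpos] at habs
  have hA1 : i * R + A * F ≤ i := by
    have : (i : ℝ) * R + i * (F + w i) = i := by rw [hR]; ring
    linarith
  have hA2 : i * R + A * F ≤ A := by
    have : A * (R + w i) + A * F = A := by rw [hR]; ring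
    linarith
  refine le_min ?_ ?_
  · rw [← one_div, le_div_iff₀ hai, ← mul_le_mul_iff_right₀ hi0]
    linarith
  · rw [← one_div, le_div_iff₀ hi0, ← mul_le_mul_iff_right₀ hai]
    linarith

end Factor

end MarkovBinomial

/-! ### Binomial averages and the smoothness of sums of fair coins -/

namespace MarkovBinomial

section BinomialAverage

/-- The expectation of `f (N + j)` for a binomial variable `N` with parameters `m` and `κ`. -/
noncomputable def binAvg (κ : ℝ) (m : ℕ) (f : ℕ → ℝ) (j : ℕ) : ℝ :=
  ∑ ij ∈ Finset.HasAntidiagonal.antidiagonal m,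
    (m.choose ij.1 : ℝ) * (κ ^ ij.1 * (1 - κ) ^ ij.2 * f (ij.1 + j))

lemma binAvg_zero (κ : ℝ) (f : ℕ → ℝ) (j : ℕ) : binAvg κ 0 f j = f j := by
  simp [binAvg]

lemma binAvg_succ (κ : ℝ) (m : ℕ) (f : ℕ → ℝ) (j : ℕ) :
    binAvg κ (m + 1) f j = κ * binAvg κ m f (j + 1) + (1 - κ) * binAvg κ m f j := by
  unfold binAvg
  rw [Finset.sum_antidiagonal_choose_succ_mul
    (fun i k => κ ^ i * (1 - κ) ^ k * f (i + j)) m, add_comm, Finset.mul_sum, Finset.mul_sum]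
  congr 1
  · refine Finset.sum_congr rfl fun x hx => ?_
    have : m.choose x.2 = m.choose x.1 := by
      rw [← Finset.HasAntidiagonal.mem_antidiagonal.1 hx, Nat.choose_symm_add]
    rw [this, add_right_comm x.1 1 j, pow_succ]
    ring_nf
  · refine Finset.sum_congr rfl fun x _ => ?_
    ring

lemma binAvg_const (κ : ℝ) (m : ℕ) (c : ℝ) (j : ℕ) : binAvg κ m (fun _ => c) j = c := by
  induction m generalizing j with
  | zero => simp [binAvg_zero]
  | succ m ih => rw [binAvg_succ, ih, ih]; ring

lemma binAvg_inv_le {κ : ℝ} (h0 : 0 < κ) (h1 : κ ≤ 1) (m : ℕ) :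
    binAvg κ m (fun i => ((i : ℝ) + 1)⁻¹) 0 ≤ ((m + 1) * κ)⁻¹ := by
  have hm : 0 < ((m : ℝ) + 1) * κ := by positivity
  rw [← one_div, le_div_iff₀ hm]
  have hc : 0 ≤ 1 - κ := by linarith
  have : binAvg κ m (fun i => ((i : ℝ) + 1)⁻¹) 0 * ((m + 1) * κ) =
      ∑ ij ∈ Finset.HasAntidiagonal.antidiagonal m, ((m + 1).choose (ij.1 + 1) : ℝ) *
        (κ ^ (ij.1 + 1) * (1 - κ) ^ ij.2) := by
    unfold binAvg
    rw [Finset.sum_mul]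
    refine Finset.sum_congr rfl fun x _ => ?_
    have h := congrArg (Nat.cast (R := ℝ)) (Nat.add_one_mul_choose_eq m x.1)
    push_cast at h
    have hx : (x.1 : ℝ) + 1 ≠ 0 := by positivity
    simp only [add_zero]
    field_simp
    rw [pow_succ]
    linear_combination (κ ^ x.1 * (1 - κ) ^ x.2 * κ) * h
  rw [this]
  have h2 : ∑ ij ∈ Finset.HasAntidiagonal.antidiagonal (m + 1), ((m + 1).choose ij.1 : ℝ) *
      (κ ^ ij.1 * (1 - κ) ^ ij.2) = 1 := by
    have := binAvg_const κ (m + 1) 1 0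
    simpa [binAvg] using this
  rw [Finset.Nat.antidiagonal_succ, Finset.sum_cons, Finset.sum_map] at h2
  simp only [Function.Embedding.prodMap, Function.Embedding.coeFn_mk, Prod.map] at h2
  have h3 : 0 ≤ ((m + 1).choose 0 : ℝ) * (κ ^ 0 * (1 - κ) ^ (m + 1)) := by positivity
  simp only [Nat.succ_eq_add_one, Function.Embedding.refl_apply] at h2
  linarith

lemma binAvg_mono {κ : ℝ} (h0 : 0 ≤ κ) (h1 : κ ≤ 1) (m : ℕ) {f g : ℕ → ℝ} (h : ∀ i, f i ≤ g i)
    (j : ℕ) : binAvg κ m f j ≤ binAvg κ m g j := by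
  have hc : 0 ≤ 1 - κ := by linarith
  unfold binAvg
  gcongr
  exact h _

/-- Jensen's inequality for the inverse square root, by the tangent line at the mean. -/
lemma binAvg_inv_sqrt_le {κ : ℝ} (h0 : 0 < κ) (h1 : κ ≤ 1) (m : ℕ) :
    binAvg κ m (fun i => (√((i : ℝ) + 1))⁻¹) 0 ≤ (√((m + 1) * κ))⁻¹ := by
  have hm : 0 < ((m : ℝ) + 1) * κ := by positivity
  set s := √(((m : ℝ) + 1) * κ) with hs
  have hs0 : 0 < s := Real.sqrt_pos.2 hm
  have hss : s * s = (m + 1) * κ := Real.mul_self_sqrt hm.le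
  have hlin : ∀ m j, binAvg κ m (fun i => s / 2 * ((i : ℝ) + 1)⁻¹ + s⁻¹ / 2) j =
      s / 2 * binAvg κ m (fun i => ((i : ℝ) + 1)⁻¹) j + s⁻¹ / 2 := by
    intro m
    induction m with
    | zero => intro j; simp [binAvg_zero]
    | succ m ih => intro j; rw [binAvg_succ, binAvg_succ, ih, ih]; ring
  calc binAvg κ m (fun i => (√((i : ℝ) + 1))⁻¹) 0
      ≤ binAvg κ m (fun i => s / 2 * ((i : ℝ) + 1)⁻¹ + s⁻¹ / 2) 0 := by
        refine binAvg_mono h0.le h1 m (fun i => ?_) 0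
        have hi : (0 : ℝ) < i + 1 := by positivity
        set x := √((i : ℝ) + 1) with hx
        have hx0 : 0 < x := Real.sqrt_pos.2 hi
        have : (i : ℝ) + 1 = x * x := (Real.mul_self_sqrt hi.le).symm
        rw [this]
        have : s / 2 * (x * x)⁻¹ + s⁻¹ / 2 - x⁻¹ = (s - x) ^ 2 / (2 * s * (x * x)) := by
          field_simp; ring
        have h2 : 0 ≤ (s - x) ^ 2 / (2 * s * (x * x)) := by positivity
        linarith
    _ = s / 2 * binAvg κ m (fun i => ((i : ℝ) + 1)⁻¹) 0 + s⁻¹ / 2 := hlin m 0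
    _ ≤ s / 2 * ((m + 1) * κ)⁻¹ + s⁻¹ / 2 := by
        gcongr; exact binAvg_inv_le h0 h1 m
    _ = s⁻¹ := by rw [← hss]; field_simp; ring

end BinomialAverage

section Coins

lemma sum_choose_mul_sq (N : ℕ) :
    ∑ i ∈ Finset.range (N + 1), (N.choose i : ℝ) * (2 * (i : ℝ) - N) ^ 2 = (N : ℝ) * 2 ^ N := by
  have h := congrArg (Polynomial.eval (1 / 2 : ℝ)) (bernsteinPolynomial.variance ℝ N)
  simp only [Polynomial.eval_finsetSum, bernsteinPolynomial, Polynomial.eval_mul,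
    Polynomial.eval_pow, Polynomial.eval_sub, Polynomial.eval_X,
    Polynomial.eval_natCast, Polynomial.eval_one, nsmul_eq_mul] at h
  have h2 : ∀ i ∈ Finset.range (N + 1), (N.choose i : ℝ) * (2 * i - N) ^ 2 =
      4 * 2 ^ N * ((N * (1 / 2 : ℝ) - i) ^ 2 *
        (N.choose i * (1 / 2) ^ i * (1 - 1 / 2) ^ (N - i))) := by
    intro i hi
    have hi' : i + (N - i) = N := by have := Finset.mem_range.1 hi; omega
    have : (2 : ℝ) ^ N * ((1 / 2) ^ i * (1 - 1 / 2) ^ (N - i)) = 1 := by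
      rw [show (1 - 1 / 2 : ℝ) = 1 / 2 by norm_num, ← pow_add, hi', ← mul_pow]; norm_num
    linear_combination (-(N.choose i : ℝ) * (2 * i - N) ^ 2) * this
  rw [Finset.sum_congr rfl h2, ← Finset.mul_sum, h]
  ring

lemma sum_choose_mul_abs_le (N : ℕ) :
    ∑ i ∈ Finset.range (N + 1), (N.choose i : ℝ) * |2 * (i : ℝ) - N| ≤ 2 ^ N * √N := by
  have hcs := Finset.sum_mul_sq_le_sq_mul_sq (Finset.range (N + 1))
    (fun i => √(N.choose i : ℝ)) (fun i => √(N.choose i : ℝ) * |2 * (i : ℝ) - N|)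
  have e1 : ∀ i : ℕ, √(N.choose i : ℝ) * (√(N.choose i : ℝ) * |2 * (i : ℝ) - N|) =
      N.choose i * |2 * (i : ℝ) - N| := fun i => by
    rw [← mul_assoc, Real.mul_self_sqrt (by positivity)]
  have e2 : ∀ i : ℕ, √(N.choose i : ℝ) ^ 2 = N.choose i := fun i =>
    Real.sq_sqrt (by positivity)
  simp only [e1, mul_pow, e2, sq_abs, sum_choose_mul_sq] at hcs
  have e3 : ∑ i ∈ Finset.range (N + 1), (N.choose i : ℝ) = 2 ^ N := by
    exact_mod_cast Nat.sum_range_choose N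
  rw [e3] at hcs
  refine le_of_sq_le_sq ?_ (by positivity)
  rw [mul_pow, Real.sq_sqrt (by positivity)]
  linarith

variable {𝔸 : Type*} [SeminormedCommRing 𝔸]

lemma norm_mul_le_of_le_one {x y : 𝔸} (hx : ‖x‖ ≤ 1) : ‖x * y‖ ≤ ‖y‖ :=
  (norm_mul_le x y).trans (mul_le_of_le_one_left (norm_nonneg y) hx)

lemma norm_pow_le_one (h1 : ‖(1 : 𝔸)‖ ≤ 1) {x : 𝔸} (hx : ‖x‖ ≤ 1) (k : ℕ) : ‖x ^ k‖ ≤ 1 := by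
  induction k with
  | zero => simpa using h1
  | succ k ih => rw [pow_succ']; exact (norm_mul_le_of_le_one hx).trans ih

variable [NormedAlgebra ℝ 𝔸] {T : 𝔸}

lemma norm_algebraMap_mul (c : ℝ) (x : 𝔸) : ‖algebraMap ℝ 𝔸 c * x‖ = |c| * ‖x‖ := by
  rw [← Algebra.smul_def, norm_smul, Real.norm_eq_abs]

/-- A sum of `j` fair coins changes by at most `1 / √(j + 1)` in total variation when it is
shifted by one: the coefficients of `(T - 1) (1 + T) ^ j` are those of `(1 + T) ^ (j + 1)`,
weighted by their centred index, so that a variance bounds their absolute sum. -/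
lemma norm_sub_one_mul_one_add_pow_le (h1 : ‖(1 : 𝔸)‖ ≤ 1) (hT : ‖T‖ ≤ 1) (j : ℕ) :
    ‖(T - 1) * (1 + T) ^ j‖ ≤ 2 ^ j * (2 * (√((j : ℝ) + 1))⁻¹) := by
  have e0 : ((j : 𝔸) + 1) * ((T - 1) * (1 + T) ^ j) =
      ∑ i ∈ Finset.range (j + 1 + 1), ((j + 1).choose i : 𝔸) * (2 * i - (j + 1)) * T ^ i := by
    have a1 : (1 + T) ^ (j + 1) =
        ∑ i ∈ Finset.range (j + 1 + 1), T ^ i * ((j + 1).choose i : 𝔸) := by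
      rw [add_comm, add_pow]; simp
    have a2 : ∑ i ∈ Finset.range (j + 1 + 1), (i : 𝔸) * ((j + 1).choose i : 𝔸) * T ^ i =
        (j + 1) * T * (1 + T) ^ j := by
      rw [Finset.sum_range_succ', add_comm 1 T, add_pow, Finset.mul_sum]
      simp only [Nat.cast_zero, zero_mul, add_zero]
      refine Finset.sum_congr rfl fun i _ => ?_
      have h := congrArg (Nat.cast (R := 𝔸)) (Nat.add_one_mul_choose_eq j i)
      push_cast [Nat.succ_eq_add_one] at h
      push_cast
      rw [one_pow, mul_one, pow_succ]
      linear_combination (-(T ^ i * T)) * h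
    have a3 : ∀ i ∈ Finset.range (j + 1 + 1),
        ((j + 1).choose i : 𝔸) * (2 * i - (j + 1)) * T ^ i =
        2 * ((i : 𝔸) * ((j + 1).choose i : 𝔸) * T ^ i) -
          (j + 1) * (T ^ i * ((j + 1).choose i : 𝔸)) := fun i _ => by ring
    rw [Finset.sum_congr rfl a3, Finset.sum_sub_distrib, ← Finset.mul_sum, ← Finset.mul_sum, a2,
      ← a1, pow_succ]
    ring
  have hN : (0 : ℝ) < (j : ℝ) + 1 := by positivity
  have e1 : ((j : ℝ) + 1) * ‖(T - 1) * (1 + T) ^ j‖ ≤ 2 ^ (j + 1) * √((j + 1 : ℕ) : ℝ) := by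
    have : ((j : 𝔸) + 1) = algebraMap ℝ 𝔸 ((j : ℝ) + 1) := by simp
    have h := norm_algebraMap_mul ((j : ℝ) + 1) ((T - 1) * (1 + T) ^ j)
    rw [← this, e0, abs_of_pos hN] at h
    rw [← h]
    refine (norm_sum_le _ _).trans (le_trans ?_ (sum_choose_mul_abs_le (j + 1)))
    refine Finset.sum_le_sum fun i _ => ?_
    have : ((j + 1).choose i : 𝔸) * (2 * i - (j + 1)) =
        algebraMap ℝ 𝔸 ((j + 1).choose i * (2 * (i : ℝ) - (j + 1))) := by simp [map_ofNat]
    rw [this, norm_algebraMap_mul, abs_mul, abs_of_nonneg (by positivity : (0:ℝ) ≤ _)]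
    push_cast
    exact mul_le_of_le_one_right (by positivity) (norm_pow_le_one h1 hT i)
  push_cast at e1
  set s := √((j : ℝ) + 1) with hs
  have hs0 : 0 < s := Real.sqrt_pos.2 hN
  have hss : s * s = (j : ℝ) + 1 := Real.mul_self_sqrt hN.le
  rw [← mul_le_mul_iff_right₀ hN]
  refine e1.trans (le_of_eq ?_)
  rw [← hss, pow_succ]
  field_simp

end Coins

end MarkovBinomial

/-! ### Smoothness of the chain sum -/

namespace MarkovBinomial

section Iterates

variable {𝔸 : Type*} [CommRing 𝔸] [Algebra ℝ 𝔸]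

/-- One step of the chain backwards in time, on a pair of generating functions indexed by the
current state; each visit to the state `1` contributes a factor `T`. -/
noncomputable def chainStep (α β : ℝ) (T : 𝔸) (y : 𝔸 × 𝔸) : 𝔸 × 𝔸 :=
  (algebraMap ℝ 𝔸 (1 - α) * y.1 + algebraMap ℝ 𝔸 α * T * y.2,
    algebraMap ℝ 𝔸 (1 - β) * y.1 + algebraMap ℝ 𝔸 β * T * y.2)

/-- The pair of generating functions after `k` steps with terminal pair `h`: for `h = (1, 1)`, the
components are `E[T ^ (X 1 + ⋯ + X k) | X 0 = i]`. -/
noncomputable def chainIter (α β : ℝ) (T : 𝔸) (h : 𝔸 × 𝔸) (k : ℕ) : 𝔸 × 𝔸 :=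
  (chainStep α β T)^[k] h

@[simp] lemma chainIter_zero (α β : ℝ) (T : 𝔸) (h : 𝔸 × 𝔸) : chainIter α β T h 0 = h := rfl

lemma chainIter_succ (α β : ℝ) (T : 𝔸) (h : 𝔸 × 𝔸) (k : ℕ) :
    chainIter α β T h (k + 1) = chainStep α β T (chainIter α β T h k) :=
  Function.iterate_succ_apply' _ _ _

lemma chainIter_succ_fst (α β : ℝ) (T : 𝔸) (h : 𝔸 × 𝔸) (k : ℕ) :
    (chainIter α β T h (k + 1)).1 = algebraMap ℝ 𝔸 (1 - α) * (chainIter α β T h k).1 +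
      algebraMap ℝ 𝔸 α * T * (chainIter α β T h k).2 := by
  rw [chainIter_succ]; rfl

lemma chainIter_succ_snd (α β : ℝ) (T : 𝔸) (h : 𝔸 × 𝔸) (k : ℕ) :
    (chainIter α β T h (k + 1)).2 = algebraMap ℝ 𝔸 (1 - β) * (chainIter α β T h k).1 +
      algebraMap ℝ 𝔸 β * T * (chainIter α β T h k).2 := by
  rw [chainIter_succ]; rfl

end Iterates

section Smoothing

variable {𝔸 : Type*} [SeminormedCommRing 𝔸] [NormedAlgebra ℝ 𝔸] {T : 𝔸} {α β : ℝ}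

lemma norm_two_terms_le {c d B : ℝ} {x y : 𝔸} (hT : ‖T‖ ≤ 1) (hc : 0 ≤ c) (hd : 0 ≤ d)
    (hx : ‖x‖ ≤ B) (hy : ‖y‖ ≤ B) :
    ‖algebraMap ℝ 𝔸 c * x + algebraMap ℝ 𝔸 d * (T * y)‖ ≤ (c + d) * B := by
  refine (norm_add_le _ _).trans ?_
  rw [norm_algebraMap_mul, norm_algebraMap_mul, abs_of_nonneg hc, abs_of_nonneg hd, add_mul]
  gcongr
  exact (norm_mul_le_of_le_one hT).trans hy

/-- A step of the chain does not increase a bound common to both components. -/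
lemma norm_chainStep_le (hT : ‖T‖ ≤ 1) (hα : α ∈ Set.Ioo (0 : ℝ) 1) (hβ : β ∈ Set.Ioo (0 : ℝ) 1)
    {u : 𝔸} {y : 𝔸 × 𝔸} {B : ℝ} (h1 : ‖u * y.1‖ ≤ B) (h2 : ‖u * y.2‖ ≤ B) :
    ‖u * (chainStep α β T y).1‖ ≤ B ∧ ‖u * (chainStep α β T y).2‖ ≤ B := by
  constructor
  · have := norm_two_terms_le (c := 1 - α) (d := α) hT (by linarith [hα.2]) hα.1.le h1 h2
    calc _ = ‖algebraMap ℝ 𝔸 (1 - α) * (u * y.1) + algebraMap ℝ 𝔸 α * (T * (u * y.2))‖ := by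
          simp only [chainStep]; congr 1; ring
      _ ≤ _ := this
      _ = B := by ring
  · have := norm_two_terms_le (c := 1 - β) (d := β) hT (by linarith [hβ.2]) hβ.1.le h1 h2
    calc _ = ‖algebraMap ℝ 𝔸 (1 - β) * (u * y.1) + algebraMap ℝ 𝔸 β * (T * (u * y.2))‖ := by
          simp only [chainStep]; congr 1; ring
      _ ≤ _ := this
      _ = B := by ring

lemma norm_chainIter_le (hT : ‖T‖ ≤ 1) (hα : α ∈ Set.Ioo (0 : ℝ) 1) (hβ : β ∈ Set.Ioo (0 : ℝ) 1)
    {u : 𝔸} {h : 𝔸 × 𝔸} {B : ℝ} (h1 : ‖u * h.1‖ ≤ B) (h2 : ‖u * h.2‖ ≤ B) (k : ℕ) :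
    ‖u * (chainIter α β T h k).1‖ ≤ B ∧ ‖u * (chainIter α β T h k).2‖ ≤ B := by
  induction k with
  | zero => exact ⟨h1, h2⟩
  | succ k ih => rw [chainIter_succ]; exact norm_chainStep_le hT hα hβ ih.1 ih.2

/-- The probability, in two steps of the chain, of a fair coin. -/
noncomputable def coinProb (α β : ℝ) : ℝ := 2 * min (1 - α) β * min α (1 - β)

lemma coinProb_pos (hα : α ∈ Set.Ioo (0 : ℝ) 1) (hβ : β ∈ Set.Ioo (0 : ℝ) 1) :
    0 < coinProb α β := by
  have h1 : 0 < min (1 - α) β := lt_min (by linarith [hα.2]) hβ.1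
  have h2 : 0 < min α (1 - β) := lt_min hα.1 (by linarith [hβ.2])
  unfold coinProb; positivity

/-- Two steps of the chain toss a fair coin with probability at least `coinProb α β`, independently
of the past: a path `x → · → y` with `x ≠ y` passes through `0` or through `1`, with weights in the
proportion `1 - α : β`, whatever `x` and `y`. -/
lemma norm_two_steps_le (hT : ‖T‖ ≤ 1) (hα : α ∈ Set.Ioo (0 : ℝ) 1) (hβ : β ∈ Set.Ioo (0 : ℝ) 1)
    {u : 𝔸} {y : 𝔸 × 𝔸} {B B' : ℝ} (h1 : ‖u * y.1‖ ≤ B) (h2 : ‖u * y.2‖ ≤ B)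
    (h1' : ‖u * (algebraMap ℝ 𝔸 (1 / 2) * (1 + T)) * y.1‖ ≤ B')
    (h2' : ‖u * (algebraMap ℝ 𝔸 (1 / 2) * (1 + T)) * y.2‖ ≤ B') :
    ‖u * (chainStep α β T (chainStep α β T y)).1‖ ≤
        coinProb α β * B' + (1 - coinProb α β) * B ∧
      ‖u * (chainStep α β T (chainStep α β T y)).2‖ ≤
        coinProb α β * B' + (1 - coinProb α β) * B := by
  set γ := min (1 - α) β with hγ
  set d := min α (1 - β) with hd
  have hγ1 : γ ≤ 1 - α := min_le_left _ _
  have hγ2 : γ ≤ β := min_le_right _ _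
  have hd1 : d ≤ α := min_le_left _ _
  have hd2 : d ≤ 1 - β := min_le_right _ _
  have hγ0 : 0 < γ := lt_min (by linarith [hα.2]) hβ.1
  have hd0 : 0 < d := lt_min hα.1 (by linarith [hβ.2])
  have hκ : coinProb α β = 2 * γ * d := rfl
  rw [hκ]
  have hα0 := hα.1
  have hα1 : 0 < 1 - α := by linarith [hα.2]
  have hβ0 := hβ.1
  have hβ1 : 0 < 1 - β := by linarith [hβ.2]
  set ι := algebraMap ℝ 𝔸 with hι
  have hTT : ‖T * T‖ ≤ 1 := (norm_mul_le_of_le_one hT).trans hT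
  have half : ι (1 / 2) * 2 = 1 := by
    rw [show (2 : 𝔸) = ι 2 by simp [hι, map_ofNat], ← map_mul]; norm_num
  -- norm of a sum of elements `ι c * x`
  have triangle : ∀ (c₁ c₂ c₃ c₄ c₅ : ℝ) (x₁ x₂ x₃ x₄ x₅ : 𝔸), 0 ≤ c₁ → 0 ≤ c₂ → 0 ≤ c₃ →
      0 ≤ c₄ → 0 ≤ c₅ → ‖x₁‖ ≤ B' → ‖x₂‖ ≤ B → ‖x₃‖ ≤ B → ‖x₄‖ ≤ B → ‖x₅‖ ≤ B →
      ‖ι c₁ * x₁ + ι c₂ * x₂ + ι c₃ * x₃ + ι c₄ * x₄ + ι c₅ * x₅‖ ≤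
        c₁ * B' + (c₂ + c₃ + c₄ + c₅) * B := by
    intro c₁ c₂ c₃ c₄ c₅ x₁ x₂ x₃ x₄ x₅ k₁ k₂ k₃ k₄ k₅ n₁ n₂ n₃ n₄ n₅
    have e : ∀ (c : ℝ) (x : 𝔸) (D : ℝ), 0 ≤ c → ‖x‖ ≤ D → ‖ι c * x‖ ≤ c * D := by
      intro c x D hc hx
      rw [norm_algebraMap_mul, abs_of_nonneg hc]
      exact mul_le_mul_of_nonneg_left hx hc
    have m₁ := e _ _ _ k₁ n₁
    have m₂ := e _ _ _ k₂ n₂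
    have m₃ := e _ _ _ k₃ n₃
    have m₄ := e _ _ _ k₄ n₄
    have m₅ := e _ _ _ k₅ n₅
    have := norm_add_le (ι c₁ * x₁ + ι c₂ * x₂ + ι c₃ * x₃ + ι c₄ * x₄) (ι c₅ * x₅)
    have := norm_add_le (ι c₁ * x₁ + ι c₂ * x₂ + ι c₃ * x₃) (ι c₄ * x₄)
    have := norm_add_le (ι c₁ * x₁ + ι c₂ * x₂) (ι c₃ * x₃)
    have := norm_add_le (ι c₁ * x₁) (ι c₂ * x₂)
    linarith
  have shift : ∀ {x : 𝔸} {D : ℝ}, ‖x‖ ≤ D → ‖T * x‖ ≤ D := fun hx =>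
    (norm_mul_le_of_le_one hT).trans hx
  have shift2 : ∀ {x : 𝔸} {D : ℝ}, ‖x‖ ≤ D → ‖(T * T) * x‖ ≤ D := fun hx =>
    (norm_mul_le_of_le_one hTT).trans hx
  constructor
  · have e : u * (chainStep α β T (chainStep α β T y)).1 =
        ι (2 * γ * d) * (T * (u * (ι (1 / 2) * (1 + T)) * y.2)) +
        ι ((1 - α) * (1 - α)) * (u * y.1) + ι (α * (1 - β)) * (T * (u * y.1)) +
        ι ((1 - α) * α - γ * d) * (T * (u * y.2)) + ι (α * β - γ * d) * (T * T * (u * y.2)) := by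
      simp only [chainStep, map_mul, map_sub, map_one, map_ofNat]
      linear_combination (-(ι γ * ι d * (T * u * (1 + T) * y.2))) * half
    rw [e]
    refine (triangle _ _ _ _ _ _ _ _ _ _ (by positivity) (by positivity) (by positivity)
      ?_ ?_ (shift h2') h1 (shift h1) (shift h2) (shift2 h2)).trans (le_of_eq (by ring))
    · nlinarith
    · nlinarith
  · have e : u * (chainStep α β T (chainStep α β T y)).2 =
        ι (2 * γ * d) * (u * (ι (1 / 2) * (1 + T)) * y.1) +
        ι ((1 - β) * (1 - α) - γ * d) * (u * y.1) + ι ((1 - β) * β - γ * d) * (T * (u * y.1)) +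
        ι ((1 - β) * α) * (T * (u * y.2)) + ι (β * β) * (T * T * (u * y.2)) := by
      simp only [chainStep, map_mul, map_sub, map_one, map_ofNat]
      linear_combination (-(ι γ * ι d * (u * (1 + T) * y.1))) * half
    rw [e]
    refine (triangle _ _ _ _ _ _ _ _ _ _ (by positivity) ?_ ?_ (by positivity) (by positivity)
      h1' h1 (shift h1) (shift h2) (shift2 h2)).trans (le_of_eq (by ring))
    · nlinarith
    · nlinarith

/-- The bound for the smoothness of the law of the chain sum over `k` steps. -/
noncomputable def smoothBound (α β : ℝ) (k : ℕ) : ℝ :=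
  √((α⁻¹ + (1 - β)⁻¹) / (min (1 - α) β * (k + 1)))

lemma coinProb_le_one (hα : α ∈ Set.Ioo (0 : ℝ) 1) (hβ : β ∈ Set.Ioo (0 : ℝ) 1) :
    coinProb α β ≤ 1 := by
  have h1 : min (1 - α) β ≤ 1 - α := min_le_left _ _
  have h2 : min α (1 - β) ≤ α := min_le_left _ _
  have h3 : 0 < min α (1 - β) := lt_min hα.1 (by linarith [hβ.2])
  unfold coinProb
  nlinarith [hα.1, hα.2, sq_nonneg (α - 1 / 2)]

lemma norm_even_chainIter_le (h1 : ‖(1 : 𝔸)‖ ≤ 1) (hT : ‖T‖ ≤ 1) (hα : α ∈ Set.Ioo (0 : ℝ) 1)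
    (hβ : β ∈ Set.Ioo (0 : ℝ) 1) {h : 𝔸 × 𝔸} {c : ℝ} (hh1 : ‖h.1‖ ≤ c) (hh2 : ‖h.2‖ ≤ c)
    (m j : ℕ) :
    ‖(T - 1) * (algebraMap ℝ 𝔸 (1 / 2) * (1 + T)) ^ j * (chainIter α β T h (2 * m)).1‖ ≤
        binAvg (coinProb α β) m (fun i => 2 * (√((i : ℝ) + 1))⁻¹ * c) j ∧
      ‖(T - 1) * (algebraMap ℝ 𝔸 (1 / 2) * (1 + T)) ^ j * (chainIter α β T h (2 * m)).2‖ ≤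
        binAvg (coinProb α β) m (fun i => 2 * (√((i : ℝ) + 1))⁻¹ * c) j := by
  induction m generalizing j with
  | zero =>
    have key : ‖(T - 1) * (algebraMap ℝ 𝔸 (1 / 2) * (1 + T)) ^ j‖ ≤ 2 * (√((j : ℝ) + 1))⁻¹ := by
      have e : (T - 1) * (algebraMap ℝ 𝔸 (1 / 2) * (1 + T)) ^ j =
          algebraMap ℝ 𝔸 ((1 / 2) ^ j) * ((T - 1) * (1 + T) ^ j) := by
        rw [mul_pow, map_pow]; ring
      rw [e, norm_algebraMap_mul, abs_of_nonneg (by positivity)]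
      refine (mul_le_mul_of_nonneg_left (norm_sub_one_mul_one_add_pow_le h1 hT j)
        (by positivity)).trans (le_of_eq ?_)
      rw [← mul_assoc, ← mul_pow]; norm_num
    simp only [mul_zero, chainIter_zero, binAvg_zero]
    have hc : 0 ≤ c := (norm_nonneg _).trans hh1
    exact ⟨(norm_mul_le _ _).trans (by gcongr), (norm_mul_le _ _).trans (by gcongr)⟩
  | succ m ih =>
    rw [binAvg_succ, show 2 * (m + 1) = 2 * m + 1 + 1 by ring, chainIter_succ, chainIter_succ]
    have i1 := ih j
    have i2 := ih (j + 1)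
    rw [pow_succ, ← mul_assoc] at i2
    exact norm_two_steps_le hT hα hβ i1.1 i1.2 i2.1 i2.2

lemma coin_bound_le (hα : α ∈ Set.Ioo (0 : ℝ) 1) (hβ : β ∈ Set.Ioo (0 : ℝ) 1) {m k : ℕ}
    (hk : k + 1 ≤ 2 * (m + 1)) :
    (√((m + 1) * coinProb α β))⁻¹ ≤ smoothBound α β k := by
  rw [← Real.sqrt_inv]
  refine Real.sqrt_le_sqrt ?_
  have hγ : 0 < min (1 - α) β := lt_min (by linarith [hα.2]) hβ.1
  have hd : 0 < min α (1 - β) := lt_min hα.1 (by linarith [hβ.2])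
  have hT : (min α (1 - β))⁻¹ ≤ α⁻¹ + (1 - β)⁻¹ := by
    have h1 : 0 < α⁻¹ := inv_pos.2 hα.1
    have h2 : 0 < (1 - β)⁻¹ := inv_pos.2 (by linarith [hβ.2])
    rcases min_choice α (1 - β) with h | h <;> rw [h] <;> linarith
  have hk' : (k : ℝ) + 1 ≤ 2 * (m + 1) := by exact_mod_cast hk
  calc ((m + 1) * coinProb α β)⁻¹ = (min α (1 - β))⁻¹ / (min (1 - α) β * (2 * (m + 1))) := by
        unfold coinProb; field_simp
    _ ≤ _ := by
        have h0 : 0 < (min α (1 - β))⁻¹ := inv_pos.2 hd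
        have h1 : 0 ≤ α⁻¹ + (1 - β)⁻¹ := h0.le.trans hT
        gcongr

/-- **Smoothness of the chain sum**: multiplication by `T - 1` makes the iterates of order
`1 / √k`, uniformly in the terminal pair. -/
lemma norm_sub_one_mul_chainIter_le (h1 : ‖(1 : 𝔸)‖ ≤ 1) (hT : ‖T‖ ≤ 1)
    (hα : α ∈ Set.Ioo (0 : ℝ) 1) (hβ : β ∈ Set.Ioo (0 : ℝ) 1) {h : 𝔸 × 𝔸} {c : ℝ}
    (hh1 : ‖h.1‖ ≤ c) (hh2 : ‖h.2‖ ≤ c) (k : ℕ) :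
    ‖(T - 1) * (chainIter α β T h k).1‖ ≤ 2 * smoothBound α β k * c ∧
      ‖(T - 1) * (chainIter α β T h k).2‖ ≤ 2 * smoothBound α β k * c := by
  have hc : 0 ≤ c := (norm_nonneg _).trans hh1
  have lin : ∀ m j, binAvg (coinProb α β) m (fun i => 2 * (√((i : ℝ) + 1))⁻¹ * c) j =
      2 * binAvg (coinProb α β) m (fun i => (√((i : ℝ) + 1))⁻¹) j * c := by
    intro m
    induction m with
    | zero => intro j; simp [binAvg_zero]
    | succ m ih => intro j; rw [binAvg_succ, binAvg_succ, ih, ih]; ring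
  have even : ∀ m k : ℕ, k + 1 ≤ 2 * (m + 1) →
      ‖(T - 1) * (chainIter α β T h (2 * m)).1‖ ≤ 2 * smoothBound α β k * c ∧
      ‖(T - 1) * (chainIter α β T h (2 * m)).2‖ ≤ 2 * smoothBound α β k * c := by
    intro m k hk
    have := norm_even_chainIter_le h1 hT hα hβ hh1 hh2 m 0
    rw [pow_zero, mul_one, lin] at this
    have hb : 2 * binAvg (coinProb α β) m (fun i => (√((i : ℝ) + 1))⁻¹) 0 * c ≤
        2 * smoothBound α β k * c := by
      gcongr
      exact (binAvg_inv_sqrt_le (coinProb_pos hα hβ) (coinProb_le_one hα hβ) m).trans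
        (coin_bound_le hα hβ hk)
    exact ⟨this.1.trans hb, this.2.trans hb⟩
  rcases Nat.even_or_odd' k with ⟨m, rfl | rfl⟩
  · exact even m _ (by omega)
  · rw [chainIter_succ]
    have := even m (2 * m + 1) (by omega)
    exact norm_chainStep_le hT hα hβ this.1 this.2

end Smoothing

end MarkovBinomial

/-! ### Generating-function identities from reversibility -/

namespace MarkovBinomial

section Identities

variable {𝔸 : Type*} [CommRing 𝔸] [Algebra ℝ 𝔸]

/-- The generating function `E[T ^ (X 1 + ⋯ + X k) | X 0 = 1]`. -/
noncomputable def genOne (α β : ℝ) (T : 𝔸) (k : ℕ) : 𝔸 := (chainIter α β T (1, 1) k).2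

/-- The generating function `E[T ^ (X 1 + ⋯ + X k) | X 0 = 0]`. -/
noncomputable def genZero (α β : ℝ) (T : 𝔸) (k : ℕ) : 𝔸 := (chainIter α β T (1, 1) k).1

/-- The quotient of `genOne - genZero` by `(β - α) (T - 1)`, by its recursion. -/
noncomputable def genDiff (α β : ℝ) (T : 𝔸) : ℕ → 𝔸
  | 0 => 0
  | k + 1 => genOne α β T k + algebraMap ℝ 𝔸 (β - α) * genDiff α β T k

/-- The quotient by `T - 1` of the increments of `genOne`: the generating function
`E[T ^ (X 1 + ⋯ + X k) X (k + 1) | X 0 = 1]`. -/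
noncomputable def genIncr (α β : ℝ) (T : 𝔸) (k : ℕ) : 𝔸 :=
  (chainIter α β T (algebraMap ℝ 𝔸 α, algebraMap ℝ 𝔸 β) k).2

/-- The value of `genDiff` at `T = 1`. -/
noncomputable def geomSum (α β : ℝ) (k : ℕ) : ℝ := ∑ i ∈ Finset.range k, (β - α) ^ i

/-- The quotient by `T - 1` of `genDiff - geomSum * genOne`, by its recursion. -/
noncomputable def genDiff₂ (α β : ℝ) (T : 𝔸) : ℕ → 𝔸
  | 0 => 0
  | k + 1 => -(algebraMap ℝ 𝔸 (geomSum α β (k + 1)) * genIncr α β T k) +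
      algebraMap ℝ 𝔸 (β - α) * genDiff₂ α β T k

/-- The generating function of the stationary chain sum over `N + 1` steps. -/
noncomputable def genStat (α β : ℝ) (T : 𝔸) (N : ℕ) : 𝔸 :=
  algebraMap ℝ 𝔸 (p α β) * T * genOne α β T N + algebraMap ℝ 𝔸 (1 - p α β) * genZero α β T N

variable {α β : ℝ} {T : 𝔸}

lemma geomSum_succ (k : ℕ) : geomSum α β (k + 1) = 1 + (β - α) * geomSum α β k := by
  unfold geomSum; rw [geom_sum_succ]; ring

lemma genOne_succ (k : ℕ) : genOne α β T (k + 1) = algebraMap ℝ 𝔸 (1 - β) * genZero α β T k +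
    algebraMap ℝ 𝔸 β * T * genOne α β T k := chainIter_succ_snd _ _ _ _ _

lemma genZero_succ (k : ℕ) : genZero α β T (k + 1) = algebraMap ℝ 𝔸 (1 - α) * genZero α β T k +
    algebraMap ℝ 𝔸 α * T * genOne α β T k := chainIter_succ_fst _ _ _ _ _

lemma genZero_eq (k : ℕ) : genZero α β T k =
    genOne α β T k - algebraMap ℝ 𝔸 (β - α) * (T - 1) * genDiff α β T k := by
  induction k with
  | zero => simp [genZero, genOne, genDiff]
  | succ k ih =>
    rw [genZero_succ, genOne_succ, genDiff, ih]
    simp only [map_sub, map_one]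
    ring

lemma chainIter_increments (k : ℕ) :
    genOne α β T (k + 1) - genOne α β T k = (T - 1) * genIncr α β T k ∧
      genZero α β T (k + 1) - genZero α β T k =
        (T - 1) * (chainIter α β T (algebraMap ℝ 𝔸 α, algebraMap ℝ 𝔸 β) k).1 := by
  induction k with
  | zero =>
    rw [genOne_succ, genZero_succ]
    simp only [genOne, genZero, genIncr, chainIter_zero, map_sub, map_one]
    constructor <;> ring
  | succ k ih =>
    have e1 := genOne_succ (α := α) (β := β) (T := T) (k + 1)
    have e2 := genZero_succ (α := α) (β := β) (T := T) (k + 1)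
    have f1 := genOne_succ (α := α) (β := β) (T := T) k
    have f2 := genZero_succ (α := α) (β := β) (T := T) k
    have g1 := chainIter_succ_snd α β T (algebraMap ℝ 𝔸 α, algebraMap ℝ 𝔸 β) k
    have g2 := chainIter_succ_fst α β T (algebraMap ℝ 𝔸 α, algebraMap ℝ 𝔸 β) k
    obtain ⟨h1, h2⟩ := ih
    unfold genIncr at h1 ⊢
    constructor
    · rw [g1]
      linear_combination e1 - f1 + algebraMap ℝ 𝔸 (1 - β) * h2 + algebraMap ℝ 𝔸 β * T * h1
    · rw [g2]
      linear_combination e2 - f2 + algebraMap ℝ 𝔸 (1 - α) * h2 + algebraMap ℝ 𝔸 α * T * h1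

lemma genDiff_sub (k : ℕ) : genDiff α β T k - algebraMap ℝ 𝔸 (geomSum α β k) * genOne α β T k =
    (T - 1) * genDiff₂ α β T k := by
  induction k with
  | zero => simp [geomSum, genDiff, genDiff₂]
  | succ k ih =>
    have h := (chainIter_increments (α := α) (β := β) (T := T) k).1
    rw [genDiff, genDiff₂]
    have hv : algebraMap ℝ 𝔸 (geomSum α β (k + 1)) =
        1 + algebraMap ℝ 𝔸 (β - α) * algebraMap ℝ 𝔸 (geomSum α β k) := by
      rw [geomSum_succ]; simp only [map_add, map_mul, map_one]
    linear_combination algebraMap ℝ 𝔸 (β - α) * ih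
      - algebraMap ℝ 𝔸 (geomSum α β (k + 1)) * h - genOne α β T k * hv

lemma detailed_balance (hα : α ∈ Set.Ioo (0 : ℝ) 1) (hβ : β ∈ Set.Ioo (0 : ℝ) 1) :
    (1 - p α β) * α = p α β * (1 - β) := by
  have : (1 - β + α) ≠ 0 := by linarith [hα.1, hβ.2]
  unfold p; field_simp; ring

lemma map_detailed_balance (hα : α ∈ Set.Ioo (0 : ℝ) 1) (hβ : β ∈ Set.Ioo (0 : ℝ) 1) :
    algebraMap ℝ 𝔸 (1 - p α β) * algebraMap ℝ 𝔸 α =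
      algebraMap ℝ 𝔸 (p α β) * algebraMap ℝ 𝔸 (1 - β) := by
  rw [← map_mul, ← map_mul, detailed_balance hα hβ]

/-- By reversibility, conditioning the chain at time `j + 1` splits the generating function of the
sum into those of the past and of the future. -/
lemma genStat_split (hα : α ∈ Set.Ioo (0 : ℝ) 1) (hβ : β ∈ Set.Ioo (0 : ℝ) 1) (j k : ℕ) :
    algebraMap ℝ 𝔸 (p α β) * T * (genOne α β T j * genOne α β T k) +
      algebraMap ℝ 𝔸 (1 - p α β) * (genZero α β T j * genZero α β T k) =
        genStat α β T (j + k) := by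
  induction j generalizing k with
  | zero => simp [genStat, genOne, genZero]
  | succ j ih =>
    rw [show j + 1 + k = j + (k + 1) by ring, ← ih (k + 1), genOne_succ, genZero_succ, genOne_succ,
      genZero_succ]
    have h := map_detailed_balance (𝔸 := 𝔸) hα hβ
    linear_combination T * (genOne α β T j * genZero α β T k -
      genZero α β T j * genOne α β T k) * h

lemma genStat_sub (hα : α ∈ Set.Ioo (0 : ℝ) 1) (hβ : β ∈ Set.Ioo (0 : ℝ) 1) (j k : ℕ) :
    genStat α β T (j + k) - genOne α β T j * genOne α β T k =
      (T - 1) * (algebraMap ℝ 𝔸 (p α β) * (genOne α β T j * genOne α β T k) -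
        algebraMap ℝ 𝔸 ((1 - p α β) * (β - α)) *
          (genDiff α β T j * genZero α β T k + genOne α β T j * genDiff α β T k)) := by
  rw [← genStat_split hα hβ j k]
  have h1 := genZero_eq (α := α) (β := β) (T := T) j
  have h2 := genZero_eq (α := α) (β := β) (T := T) k
  simp only [map_mul, map_sub, map_one] at h1 h2 ⊢
  linear_combination (1 - algebraMap ℝ 𝔸 (p α β)) * genZero α β T k * h1 +
    (1 - algebraMap ℝ 𝔸 (p α β)) * genOne α β T j * h2

/-- The two-sided correction to `genStat`, in a form symmetric in past and future. -/
lemma genStat_sub' (hα : α ∈ Set.Ioo (0 : ℝ) 1) (hβ : β ∈ Set.Ioo (0 : ℝ) 1) (j k : ℕ) :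
    genStat α β T (j + k) - genOne α β T j * genOne α β T k =
      (T - 1) * (algebraMap ℝ 𝔸 (p α β) * (genOne α β T j * genOne α β T k) -
        algebraMap ℝ 𝔸 (1 - p α β) * (algebraMap ℝ 𝔸 (β - α) *
          (genDiff α β T j * genOne α β T k + genOne α β T j * genDiff α β T k) -
          algebraMap ℝ 𝔸 (β - α) ^ 2 * (T - 1) * (genDiff α β T j * genDiff α β T k))) := by
  rw [genStat_sub hα hβ, genZero_eq k]
  simp only [map_mul]
  ring

/-- The symmetric sum over the position of a marked visit that governs the Stein functional. -/
noncomputable def defect (α β : ℝ) (T : 𝔸) (c : ℝ) (N : ℕ) : 𝔸 :=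
  ∑ u ∈ Finset.range (N + 1), (algebraMap ℝ 𝔸 c * (genOne α β T u * genOne α β T (N - u)) -
    (algebraMap ℝ 𝔸 (β - α) *
      (genDiff α β T u * genOne α β T (N - u) + genOne α β T u * genDiff α β T (N - u)) -
      algebraMap ℝ 𝔸 (β - α) ^ 2 * (T - 1) * (genDiff α β T u * genDiff α β T (N - u))))

/-- The average of `geomSum` over the positions of a marked visit. -/
noncomputable def avgGeom (α β : ℝ) (N : ℕ) : ℝ :=
  (∑ u ∈ Finset.range (N + 1), geomSum α β u) / (N + 1)

/-- For the constant that makes `defect` vanish at `T = 1`, each of its terms is a multiple of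
`T - 1`. -/
lemma defect_eq (hα : α ∈ Set.Ioo (0 : ℝ) 1) (hβ : β ∈ Set.Ioo (0 : ℝ) 1) (N : ℕ) :
    defect α β T (2 * (β - α) * avgGeom α β N) N = ∑ u ∈ Finset.range (N + 1),
      (T - 1) * (-(algebraMap ℝ 𝔸 (2 * (β - α) * (avgGeom α β N - geomSum α β u)) *
          (algebraMap ℝ 𝔸 (p α β) * (genOne α β T u * genOne α β T (N - u)) -
            algebraMap ℝ 𝔸 ((1 - p α β) * (β - α)) *
            (genDiff α β T u * genZero α β T (N - u) + genOne α β T u * genDiff α β T (N - u))))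
        - algebraMap ℝ 𝔸 (2 * (β - α)) * (genDiff₂ α β T u * genOne α β T (N - u))
        + algebraMap ℝ 𝔸 ((β - α) ^ 2) * (genDiff α β T u * genDiff α β T (N - u))) := by
  have hrefl : ∑ u ∈ Finset.range (N + 1), genOne α β T u * genDiff α β T (N - u) =
      ∑ u ∈ Finset.range (N + 1), genDiff α β T u * genOne α β T (N - u) := by
    rw [← Finset.sum_range_reflect]
    refine Finset.sum_congr rfl fun u hu => ?_
    have := Finset.mem_range.1 hu
    rw [show N + 1 - 1 - u = N - u by omega, show N - (N - u) = u by omega, mul_comm]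
  have hzero : ∑ u ∈ Finset.range (N + 1),
      algebraMap ℝ 𝔸 (2 * (β - α) * (avgGeom α β N - geomSum α β u)) * genStat α β T N = 0 := by
    rw [← Finset.sum_mul, ← map_sum, ← Finset.mul_sum, Finset.sum_sub_distrib]
    have : ∑ u ∈ Finset.range (N + 1), avgGeom α β N =
        ∑ u ∈ Finset.range (N + 1), geomSum α β u := by
      have hN : (N : ℝ) + 1 ≠ 0 := by positivity
      unfold avgGeom
      rw [Finset.sum_const, Finset.card_range, nsmul_eq_mul]
      push_cast
      field_simp
    rw [this]; simp
  have hsplit : defect α β T (2 * (β - α) * avgGeom α β N) N = ∑ u ∈ Finset.range (N + 1),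
      (algebraMap ℝ 𝔸 (2 * (β - α) * avgGeom α β N) * (genOne α β T u * genOne α β T (N - u)) -
      algebraMap ℝ 𝔸 (2 * (β - α)) * (genDiff α β T u * genOne α β T (N - u)) +
      algebraMap ℝ 𝔸 (β - α) ^ 2 * (T - 1) * (genDiff α β T u * genDiff α β T (N - u))) := by
    unfold defect
    simp only [Finset.sum_add_distrib, Finset.sum_sub_distrib, ← Finset.mul_sum, hrefl]
    simp only [map_mul, map_ofNat]
    ring
  rw [hsplit, ← sub_zero (Finset.sum _ _), ← hzero, ← Finset.sum_sub_distrib]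
  refine Finset.sum_congr rfl fun u hu => ?_
  have hu' : u + (N - u) = N := by have := Finset.mem_range.1 hu; omega
  have h := genStat_sub (T := T) hα hβ u (N - u)
  rw [hu'] at h
  have h2 := genDiff_sub (α := α) (β := β) (T := T) u
  simp only [map_mul, map_sub, map_ofNat, map_one, map_pow] at h h2 ⊢
  linear_combination (-(2 * (algebraMap ℝ 𝔸 β - algebraMap ℝ 𝔸 α) *
    (algebraMap ℝ 𝔸 (avgGeom α β N) - algebraMap ℝ 𝔸 (geomSum α β u)))) * h
    - (2 * (algebraMap ℝ 𝔸 β - algebraMap ℝ 𝔸 α) * genOne α β T (N - u)) * h2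

end Identities

end MarkovBinomial

/-! ### Bound of the defect -/

namespace MarkovBinomial

section Bounds

variable {𝔸 : Type*} [SeminormedCommRing 𝔸] {T : 𝔸} {α β : ℝ}

/-- The sequence `G` is bounded by `a` and, from the index `2 t` on, its product with `T - 1` is
smaller by the factor `η`. -/
def IsSmoothSeq (T : 𝔸) (t : ℕ) (η a : ℝ) (G : ℕ → 𝔸) : Prop :=
  ∀ k, ‖G k‖ ≤ a ∧ (2 * t ≤ k → ‖(T - 1) * G k‖ ≤ a * η)

lemma IsSmoothSeq.mul {t : ℕ} {η a b : ℝ} {G H : ℕ → 𝔸} (hG : IsSmoothSeq T t η a G)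
    (hH : IsSmoothSeq T t η b H) {j k : ℕ} (hjk : 2 * t ≤ j ∨ 2 * t ≤ k) :
    ‖(T - 1) * (G j * H k)‖ ≤ a * b * η := by
  obtain ⟨g1, g2⟩ := hG j
  obtain ⟨h1, h2⟩ := hH k
  have ha : 0 ≤ a := (norm_nonneg _).trans g1
  have hb : 0 ≤ b := (norm_nonneg _).trans h1
  rcases hjk with h | h
  · rw [← mul_assoc]
    refine (norm_mul_le _ _).trans ((mul_le_mul (g2 h) h1 (norm_nonneg _) ?_).trans
      (le_of_eq (by ring)))
    exact (norm_nonneg _).trans (g2 h)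
  · rw [mul_left_comm]
    refine (norm_mul_le _ _).trans ((mul_le_mul g1 (h2 h) (norm_nonneg _) ha).trans
      (le_of_eq (by ring)))

variable [NormedAlgebra ℝ 𝔸]

lemma smoothBound_nonneg (k : ℕ) : 0 ≤ smoothBound α β k := Real.sqrt_nonneg _

lemma smoothBound_anti (hα : α ∈ Set.Ioo (0 : ℝ) 1) (hβ : β ∈ Set.Ioo (0 : ℝ) 1) {j k : ℕ}
    (hjk : j ≤ k) : smoothBound α β k ≤ smoothBound α β j := by
  have hγ : 0 < min (1 - α) β := lt_min (by linarith [hα.2]) hβ.1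
  have h1 : 0 < α⁻¹ := inv_pos.2 hα.1
  have h2 : 0 < (1 - β)⁻¹ := inv_pos.2 (by linarith [hβ.2])
  unfold smoothBound
  gcongr

/-- A geometrically damped sum of a smooth sequence is smooth: the terms with a small index, for
which nothing is gained, carry the weight `|β - α| ^ t`. -/
lemma isSmoothSeq_of_recursion (h1 : ‖(1 : 𝔸)‖ ≤ 1) (hT : ‖T‖ ≤ 1) {ρ c e : ℝ} (hρ : |ρ| < 1)
    (he : 0 ≤ e) {t : ℕ} {G y : ℕ → 𝔸} (h0 : G 0 = 0)
    (hG : ∀ k, G (k + 1) = y k + algebraMap ℝ 𝔸 ρ * G k) (hy : ∀ k, ‖y k‖ ≤ c)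
    (hy' : ∀ k, t ≤ k → ‖(T - 1) * y k‖ ≤ 2 * e * c) :
    IsSmoothSeq T t (2 * (e + |ρ| ^ t)) (c / (1 - |ρ|)) G := by
  have hr0 := abs_nonneg ρ
  set r := |ρ| with hr
  have hd : 0 < 1 - r := by linarith
  have hc : 0 ≤ c := (norm_nonneg _).trans (hy 0)
  have hcd : 0 ≤ c / (1 - r) := by positivity
  have hsplit : c = (1 - r) * (c / (1 - r)) := by field_simp
  set a := c / (1 - r) with ha
  have bound : ∀ k, ‖G k‖ ≤ a := by
    intro k
    induction k with
    | zero => rw [h0, norm_zero]; exact hcd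
    | succ k ih =>
      rw [hG]
      refine (norm_add_le _ _).trans ?_
      rw [norm_algebraMap_mul, ← hr]
      have := hy k
      have := mul_le_mul_of_nonneg_left ih hr0
      linarith
  have h2 : ‖T - 1‖ ≤ 2 := (norm_sub_le _ _).trans (by linarith)
  have step : ∀ j, ‖(T - 1) * G (t + j)‖ ≤ a * (2 * (e + r ^ j)) := by
    intro j
    induction j with
    | zero =>
      have := mul_le_mul h2 (bound t) (norm_nonneg _) (by norm_num)
      have := norm_mul_le (T - 1) (G t)
      have := mul_nonneg hcd he
      rw [add_zero, pow_zero]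
      linarith
    | succ j ih =>
      rw [← add_assoc, hG, mul_add, mul_left_comm]
      refine (norm_add_le _ _).trans ?_
      rw [norm_algebraMap_mul, ← hr]
      have h3 := hy' (t + j) (by omega)
      have h4 := mul_le_mul_of_nonneg_left ih hr0
      rw [pow_succ]
      have : 2 * e * c = 2 * e * ((1 - r) * a) := by rw [← hsplit]
      rw [this] at h3
      linarith
  intro k
  refine ⟨bound k, fun hk => ?_⟩
  obtain ⟨j, rfl⟩ := Nat.exists_eq_add_of_le (show t ≤ k by omega)
  refine (step j).trans ?_
  have : r ^ j ≤ r ^ t := pow_le_pow_of_le_one hr0 hρ.le (by omega)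
  gcongr

lemma abs_sub_lt_one (hα : α ∈ Set.Ioo (0 : ℝ) 1) (hβ : β ∈ Set.Ioo (0 : ℝ) 1) :
    |β - α| < 1 := abs_lt.2 ⟨by linarith [hα.2, hβ.1], by linarith [hα.1, hβ.2]⟩

lemma abs_sub_le_max (hα : α ∈ Set.Ioo (0 : ℝ) 1) (hβ : β ∈ Set.Ioo (0 : ℝ) 1) :
    |β - α| ≤ max α β :=
  abs_le.2 ⟨by linarith [le_max_left α β, hβ.1], by linarith [le_max_right α β, hα.1]⟩

lemma geomSum_nonneg (hα : α ∈ Set.Ioo (0 : ℝ) 1) (hβ : β ∈ Set.Ioo (0 : ℝ) 1) (k : ℕ) :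
    0 ≤ geomSum α β k := by
  have h := geom_sum_mul_neg (β - α) k
  have h1 := abs_sub_lt_one hα hβ
  have h2 : (β - α) ^ k ≤ 1 :=
    (le_abs_self _).trans (by rw [abs_pow]; exact pow_le_one₀ (abs_nonneg _) h1.le)
  have h3 : 0 < 1 - (β - α) := by linarith [le_abs_self (β - α)]
  refine nonneg_of_mul_nonneg_left ?_ h3
  unfold geomSum; rw [h]; linarith

lemma geomSum_le (hα : α ∈ Set.Ioo (0 : ℝ) 1) (hβ : β ∈ Set.Ioo (0 : ℝ) 1) (k : ℕ) :
    geomSum α β k ≤ (1 - |β - α|)⁻¹ := by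
  have h1 := abs_sub_lt_one hα hβ
  have hd : 0 < 1 - |β - α| := by linarith
  induction k with
  | zero => simp only [geomSum, Finset.range_zero, Finset.sum_empty]; positivity
  | succ k ih =>
    rw [geomSum_succ]
    have h2 : (β - α) * geomSum α β k ≤ |β - α| * (1 - |β - α|)⁻¹ :=
      mul_le_mul (le_abs_self _) ih (geomSum_nonneg hα hβ k) (abs_nonneg _)
    have : 1 + |β - α| * (1 - |β - α|)⁻¹ = (1 - |β - α|)⁻¹ := by field_simp; ring
    linarith

lemma avgGeom_nonneg (hα : α ∈ Set.Ioo (0 : ℝ) 1) (hβ : β ∈ Set.Ioo (0 : ℝ) 1) (N : ℕ) :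
    0 ≤ avgGeom α β N :=
  div_nonneg (Finset.sum_nonneg fun u _ => geomSum_nonneg hα hβ u) (by positivity)

lemma abs_avgGeom_sub_le (hα : α ∈ Set.Ioo (0 : ℝ) 1) (hβ : β ∈ Set.Ioo (0 : ℝ) 1) (N u : ℕ) :
    |avgGeom α β N - geomSum α β u| ≤ (1 - |β - α|)⁻¹ := by
  have h0 := avgGeom_nonneg hα hβ N
  have h1 : avgGeom α β N ≤ (1 - |β - α|)⁻¹ := by
    have hN : (0 : ℝ) < N + 1 := by positivity
    rw [avgGeom, div_le_iff₀ hN]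
    refine (Finset.sum_le_sum fun u _ => geomSum_le hα hβ u).trans (le_of_eq ?_)
    rw [Finset.sum_const, Finset.card_range, nsmul_eq_mul]; push_cast; ring
  have h2 := geomSum_nonneg hα hβ u
  have h3 := geomSum_le hα hβ u
  rw [abs_le]; constructor <;> linarith

lemma p_pos (hα : α ∈ Set.Ioo (0 : ℝ) 1) (hβ : β ∈ Set.Ioo (0 : ℝ) 1) : 0 < p α β :=
  div_pos hα.1 (by linarith [hα.1, hβ.2])

lemma p_lt_one (hα : α ∈ Set.Ioo (0 : ℝ) 1) (hβ : β ∈ Set.Ioo (0 : ℝ) 1) : p α β < 1 := by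
  have : 0 < 1 - β + α := by linarith [hα.1, hβ.2]
  rw [p, div_lt_one this]; linarith [hβ.2]

/-- The scale of the smoothness gained from one of two complementary pieces of a chain of length
`n`. -/
noncomputable def smoothScale (α β : ℝ) (n : ℕ) : ℝ :=
  2 * (smoothBound α β (n / 4) + |β - α| ^ (n / 4))

lemma isSmoothSeq_chainIter (h1 : ‖(1 : 𝔸)‖ ≤ 1) (hT : ‖T‖ ≤ 1) (hα : α ∈ Set.Ioo (0 : ℝ) 1)
    (hβ : β ∈ Set.Ioo (0 : ℝ) 1) (n : ℕ) :
    IsSmoothSeq T (n / 4) (smoothScale α β n) 1 (genOne α β T) ∧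
      IsSmoothSeq T (n / 4) (smoothScale α β n) 1 (genZero α β T) := by
  have key : ∀ k, n / 4 ≤ k → 2 * smoothBound α β k * 1 ≤ 1 * smoothScale α β n := by
    intro k hk
    have h2 := smoothBound_anti hα hβ hk
    have h3 : 0 ≤ |β - α| ^ (n / 4) := by positivity
    unfold smoothScale
    linarith
  constructor <;> intro k
  · refine ⟨?_, fun hk => ?_⟩
    · have := (norm_chainIter_le (u := 1) hT hα hβ (h := ((1 : 𝔸), (1 : 𝔸))) (B := 1)
        (by simpa using h1) (by simpa using h1) k).2
      simpa [genOne] using this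
    · exact (norm_sub_one_mul_chainIter_le h1 hT hα hβ (h := ((1 : 𝔸), (1 : 𝔸))) h1 h1 k).2.trans
        (key k (by omega))
  · refine ⟨?_, fun hk => ?_⟩
    · have := (norm_chainIter_le (u := 1) hT hα hβ (h := ((1 : 𝔸), (1 : 𝔸))) (B := 1)
        (by simpa using h1) (by simpa using h1) k).1
      simpa [genZero] using this
    · exact (norm_sub_one_mul_chainIter_le h1 hT hα hβ (h := ((1 : 𝔸), (1 : 𝔸))) h1 h1 k).1.trans
        (key k (by omega))

lemma isSmoothSeq_genDiff (h1 : ‖(1 : 𝔸)‖ ≤ 1) (hT : ‖T‖ ≤ 1) (hα : α ∈ Set.Ioo (0 : ℝ) 1)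
    (hβ : β ∈ Set.Ioo (0 : ℝ) 1) (n : ℕ) :
    IsSmoothSeq T (n / 4) (smoothScale α β n) (1 / (1 - |β - α|)) (genDiff α β T) := by
  refine isSmoothSeq_of_recursion h1 hT (abs_sub_lt_one hα hβ) (smoothBound_nonneg _) rfl
    (y := genOne α β T) (fun k => rfl) (fun k => ((isSmoothSeq_chainIter h1 hT hα hβ n).1 k).1) ?_
  intro k hk
  have h2 := smoothBound_anti hα hβ hk
  have h3 := (norm_sub_one_mul_chainIter_le h1 hT hα hβ (h := ((1 : 𝔸), (1 : 𝔸))) h1 h1 k).2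
  exact h3.trans (by linarith)

lemma isSmoothSeq_genDiff₂ (h1 : ‖(1 : 𝔸)‖ ≤ 1) (hT : ‖T‖ ≤ 1) (hα : α ∈ Set.Ioo (0 : ℝ) 1)
    (hβ : β ∈ Set.Ioo (0 : ℝ) 1) (n : ℕ) :
    IsSmoothSeq T (n / 4) (smoothScale α β n)
      ((1 - |β - α|)⁻¹ * max α β / (1 - |β - α|)) (genDiff₂ α β T) := by
  have hd : 0 < 1 - |β - α| := by linarith [abs_sub_lt_one hα hβ]
  have hM : 0 < max α β := lt_max_of_lt_left hα.1
  have hi1 : ‖algebraMap ℝ 𝔸 α‖ ≤ max α β := by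
    have := norm_algebraMap_mul α (1 : 𝔸)
    rw [mul_one, abs_of_pos hα.1] at this
    rw [this]
    exact (mul_le_of_le_one_right hα.1.le h1).trans (le_max_left _ _)
  have hi2 : ‖algebraMap ℝ 𝔸 β‖ ≤ max α β := by
    have := norm_algebraMap_mul β (1 : 𝔸)
    rw [mul_one, abs_of_pos hβ.1] at this
    rw [this]
    exact (mul_le_of_le_one_right hβ.1.le h1).trans (le_max_right _ _)
  have hg : ∀ k, |geomSum α β k| ≤ (1 - |β - α|)⁻¹ := fun k => by
    rw [abs_of_nonneg (geomSum_nonneg hα hβ k)]; exact geomSum_le hα hβ k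
  refine isSmoothSeq_of_recursion h1 hT (abs_sub_lt_one hα hβ) (smoothBound_nonneg _) rfl
    (y := fun k => -(algebraMap ℝ 𝔸 (geomSum α β (k + 1)) * genIncr α β T k))
    (fun k => rfl) (fun k => ?_) (fun k hk => ?_)
  · rw [norm_neg, norm_algebraMap_mul]
    have := (norm_chainIter_le (u := 1) hT hα hβ
      (h := (algebraMap ℝ 𝔸 α, algebraMap ℝ 𝔸 β)) (B := max α β)
      (by simpa using hi1) (by simpa using hi2) k).2
    rw [one_mul] at this
    exact mul_le_mul (hg _) this (norm_nonneg _) (by positivity)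
  · rw [mul_neg, norm_neg, mul_left_comm, norm_algebraMap_mul]
    have h2 := smoothBound_anti hα hβ hk
    have h3 := (norm_sub_one_mul_chainIter_le h1 hT hα hβ
      (h := (algebraMap ℝ 𝔸 α, algebraMap ℝ 𝔸 β)) hi1 hi2 k).2
    have h4 : ‖(T - 1) * genIncr α β T k‖ ≤ 2 * smoothBound α β (n / 4) * max α β :=
      h3.trans (by gcongr)
    exact (mul_le_mul (hg _) h4 (norm_nonneg _) (by positivity)).trans (le_of_eq (by ring))

/-- The matched defect is small: it is proportional to `β - α`, and each of its terms contains a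
long piece of the chain to be smoothed. -/
lemma norm_defect_le (h1 : ‖(1 : 𝔸)‖ ≤ 1) (hT : ‖T‖ ≤ 1) (hα : α ∈ Set.Ioo (0 : ℝ) 1)
    (hβ : β ∈ Set.Ioo (0 : ℝ) 1) (N : ℕ) :
    ‖defect α β T (2 * (β - α) * avgGeom α β N) N‖ ≤
      (N + 1) * (9 * max α β * |β - α| / (1 - |β - α|) ^ 2 * smoothScale α β (N + 1)) := by
  rw [defect_eq hα hβ]
  have hr1 := abs_sub_lt_one hα hβ
  have hrM := abs_sub_le_max hα hβ
  have hr0 := abs_nonneg (β - α)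
  have hp0 := p_pos hα hβ
  have hp1 := p_lt_one hα hβ
  have hpM : p α β * (1 - |β - α|) ≤ max α β := by
    have h3 : 0 < 1 - β + α := by linarith [hα.1, hβ.2]
    have h4 : 1 - |β - α| ≤ 1 - β + α := by linarith [le_abs_self (β - α)]
    calc p α β * (1 - |β - α|) ≤ p α β * (1 - β + α) := by gcongr
      _ = α := by unfold p; field_simp
      _ ≤ max α β := le_max_left _ _
  set r := |β - α| with hr
  set M := max α β with hM
  set η := smoothScale α β (N + 1) with hη
  have hd : 0 < 1 - r := by linarith
  have hη0 : 0 ≤ η := by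
    have := smoothBound_nonneg (α := α) (β := β) ((N + 1) / 4)
    rw [hη, smoothScale]; positivity
  obtain ⟨sA, sZ⟩ := isSmoothSeq_chainIter h1 hT hα hβ (N + 1)
  have sV := isSmoothSeq_genDiff h1 hT hα hβ (N + 1)
  have sW := isSmoothSeq_genDiff₂ h1 hT hα hβ (N + 1)
  rw [← hη, ← hr] at sV sW
  rw [← hη] at sA sZ
  rw [← hM] at sW
  refine (norm_sum_le _ _).trans ((Finset.sum_le_card_nsmul _ _
    (9 * M * r / (1 - r) ^ 2 * η) fun u hu => ?_).trans (le_of_eq ?_))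
  · have hu' := Finset.mem_range.1 hu
    have hlong : 2 * ((N + 1) / 4) ≤ u ∨ 2 * ((N + 1) / 4) ≤ N - u := by omega
    have b1 := sA.mul sA hlong
    have b2 := sV.mul sZ hlong
    have b3 := sA.mul sV hlong
    have b4 := sW.mul sA hlong
    have b5 := sV.mul sV hlong
    set k := N - u with hk
    have habs := abs_avgGeom_sub_le hα hβ N u
    rw [← hr] at habs
    have e : ∀ (c : ℝ) (x : 𝔸), ‖algebraMap ℝ 𝔸 c * x‖ = |c| * ‖x‖ := norm_algebraMap_mul
    have expand : ∀ (c₁ c₂ c₃ c₄ c₅ : ℝ) (x₁ x₂ x₃ x₄ x₅ : 𝔸),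
        ‖(T - 1) * (-(algebraMap ℝ 𝔸 c₁ * (algebraMap ℝ 𝔸 c₂ * x₁ -
          algebraMap ℝ 𝔸 c₃ * (x₂ + x₃))) - algebraMap ℝ 𝔸 c₄ * x₄ + algebraMap ℝ 𝔸 c₅ * x₅)‖ ≤
        |c₁| * (|c₂| * ‖(T - 1) * x₁‖ + |c₃| * (‖(T - 1) * x₂‖ + ‖(T - 1) * x₃‖)) +
          |c₄| * ‖(T - 1) * x₄‖ + |c₅| * ‖(T - 1) * x₅‖ := by
      intro c₁ c₂ c₃ c₄ c₅ x₁ x₂ x₃ x₄ x₅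
      have : (T - 1) * (-(algebraMap ℝ 𝔸 c₁ * (algebraMap ℝ 𝔸 c₂ * x₁ -
          algebraMap ℝ 𝔸 c₃ * (x₂ + x₃))) - algebraMap ℝ 𝔸 c₄ * x₄ + algebraMap ℝ 𝔸 c₅ * x₅) =
        -(algebraMap ℝ 𝔸 c₁ * (algebraMap ℝ 𝔸 c₂ * ((T - 1) * x₁) -
          algebraMap ℝ 𝔸 c₃ * ((T - 1) * x₂ + (T - 1) * x₃))) -
          algebraMap ℝ 𝔸 c₄ * ((T - 1) * x₄) + algebraMap ℝ 𝔸 c₅ * ((T - 1) * x₅) := by ring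
      rw [this]
      refine (norm_add_le _ _).trans ?_
      rw [e c₅]
      refine add_le_add_left ((norm_sub_le _ _).trans ?_) _
      rw [e c₄, norm_neg, e c₁]
      refine add_le_add_left (mul_le_mul_of_nonneg_left ((norm_sub_le _ _).trans ?_)
        (abs_nonneg _)) _
      rw [e c₂, e c₃]
      gcongr
      exact norm_add_le _ _
    refine (expand _ _ _ _ _ _ _ _ _ _).trans ?_
    have a1 : |2 * (β - α) * (avgGeom α β N - geomSum α β u)| ≤ 2 * r * (1 - r)⁻¹ := by
      rw [abs_mul, abs_mul, ← hr, abs_two]; gcongr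
    have a2 : |p α β| = p α β := abs_of_pos hp0
    have a3 : |(1 - p α β) * (β - α)| ≤ r := by
      rw [abs_mul, ← hr, abs_of_pos (by linarith)]
      exact mul_le_of_le_one_left hr0 (by linarith)
    have a4 : |2 * (β - α)| = 2 * r := by rw [abs_mul, ← hr, abs_two]
    have a5 : |(β - α) ^ 2| = r ^ 2 := by rw [abs_pow]
    rw [a2, a4, a5]
    calc _ ≤ 2 * r * (1 - r)⁻¹ * (p α β * (1 * 1 * η) +
            r * (1 / (1 - r) * 1 * η + 1 * (1 / (1 - r)) * η)) +
          2 * r * ((1 - r)⁻¹ * M / (1 - r) * 1 * η) +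
          r ^ 2 * (1 / (1 - r) * (1 / (1 - r)) * η) := by gcongr
      _ = (r * (2 * (p α β * (1 - r)) + 4 * r + 2 * M + r)) / (1 - r) ^ 2 * η := by
          field_simp; ring
      _ ≤ (r * (2 * M + 4 * M + 2 * M + M)) / (1 - r) ^ 2 * η := by gcongr
      _ = _ := by ring
  · rw [Finset.card_range, nsmul_eq_mul]; push_cast; ring

end Bounds

end MarkovBinomial

/-! ### The Stein operator as a functional of the generating function -/

namespace MarkovBinomial

open Polynomial
open scoped BoundedContinuousFunction

section Functional

/-- The linear functional on polynomials that maps `X ^ k` to `g k`; on the generating function of a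
random variable `S` it is `E[g S]`. -/
noncomputable def polyEval (g : ℕ → ℝ) : ℝ[X] →ₗ[ℝ] ℝ :=
  Polynomial.lsum fun k => g k • (LinearMap.id : ℝ →ₗ[ℝ] ℝ)

@[simp] lemma polyEval_monomial (g : ℕ → ℝ) (k : ℕ) (c : ℝ) :
    polyEval g (monomial k c) = g k * c := by
  simp [polyEval, Polynomial.lsum_apply, Polynomial.sum_monomial_index]

lemma polyEval_X_mul (g : ℕ → ℝ) (P : ℝ[X]) :
    polyEval g (X * P) = polyEval (fun k => g (k + 1)) P := by
  induction P using Polynomial.induction_on' with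
  | add P Q hP hQ => rw [mul_add, map_add, map_add, hP, hQ]
  | monomial k c => rw [X_mul_monomial, polyEval_monomial, polyEval_monomial]

lemma polyEval_sub_left (g h : ℕ → ℝ) (P : ℝ[X]) :
    polyEval (fun k => g k - h k) P = polyEval g P - polyEval h P := by
  induction P using Polynomial.induction_on' with
  | add P Q hP hQ => rw [map_add, map_add, map_add, hP, hQ]; ring
  | monomial k c => simp only [polyEval_monomial]; ring

lemma polyEval_C_mul (g : ℕ → ℝ) (c : ℝ) (P : ℝ[X]) :
    polyEval g (C c * P) = c * polyEval g P := by
  rw [← smul_eq_C_mul, map_smul, smul_eq_mul]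

lemma polyEval_one (P : ℝ[X]) : polyEval (fun _ => 1) P = P.eval 1 := by
  induction P using Polynomial.induction_on' with
  | add P Q hP hQ => rw [map_add, hP, hQ, eval_add]
  | monomial k c => simp

/-- The Stein operator `g ↦ (a + b k) g (k + 1) - k g k`, as a differential operator on generating
functions. -/
lemma polyEval_stein (a b : ℝ) (g : ℕ → ℝ) (P : ℝ[X]) :
    polyEval (fun k => (a + b * k) * g (k + 1) - k * g k) P =
      polyEval g (X * (C a * P + C b * X * derivative P - derivative P)) := by
  induction P using Polynomial.induction_on' with
  | add P Q hP hQ =>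
    rw [map_add, hP, hQ, ← map_add, derivative_add]
    congr 1; ring
  | monomial k c =>
    rw [polyEval_X_mul, polyEval_monomial, derivative_monomial, map_sub, map_add, mul_assoc,
      polyEval_C_mul, polyEval_C_mul, polyEval_X_mul, polyEval_monomial, polyEval_monomial,
      polyEval_monomial]
    rcases k with _ | k
    · simp; ring
    · simp only [Nat.add_sub_cancel]; push_cast; ring

/-- The shift on bounded functions on `ℕ`. -/
noncomputable def shiftCLM : (ℕ →ᵇ ℝ) →L[ℝ] (ℕ →ᵇ ℝ) :=
  LinearMap.mkContinuous
    { toFun := fun g => g.compContinuous ⟨fun k => k + 1, continuous_of_discreteTopology⟩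
      map_add' := fun _ _ => rfl
      map_smul' := fun _ _ => rfl } 1 fun g => by
    rw [one_mul]
    exact (BoundedContinuousFunction.norm_le (norm_nonneg g)).2 fun k => g.norm_coe_le_norm (k + 1)

lemma norm_shiftCLM_le : ‖shiftCLM‖ ≤ 1 := LinearMap.mkContinuous_norm_le _ zero_le_one _

lemma shiftCLM_pow_apply (g : ℕ →ᵇ ℝ) (k j : ℕ) : (shiftCLM ^ k) g j = g (j + k) := by
  induction k generalizing j with
  | zero => rfl
  | succ k ih =>
    rw [pow_succ']
    change ((shiftCLM ^ k) g) (j + 1) = _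
    rw [ih, add_right_comm, add_assoc]

/-- The norm of a polynomial as an operator on bounded functions on `ℕ`, with `X` acting as the
shift (this is the sum of the absolute values of the coefficients, a fact that is not needed). -/
noncomputable abbrev polySeminormedCommRing : SeminormedCommRing ℝ[X] :=
  SeminormedCommRing.induced ℝ[X] ((ℕ →ᵇ ℝ) →L[ℝ] (ℕ →ᵇ ℝ)) (aeval shiftCLM)

attribute [local instance] polySeminormedCommRing

/-- The normed algebra structure that goes with `polySeminormedCommRing`. -/
noncomputable abbrev polyNormedAlgebra : NormedAlgebra ℝ ℝ[X] :=
  NormedAlgebra.induced ℝ ℝ[X] ((ℕ →ᵇ ℝ) →L[ℝ] (ℕ →ᵇ ℝ)) (aeval shiftCLM)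

attribute [local instance] polyNormedAlgebra

lemma poly_norm_def (P : ℝ[X]) : ‖P‖ = ‖aeval shiftCLM P‖ := rfl

lemma norm_poly_X_le : ‖(X : ℝ[X])‖ ≤ 1 := by
  rw [poly_norm_def, aeval_X]; exact norm_shiftCLM_le

lemma norm_poly_one_le : ‖(1 : ℝ[X])‖ ≤ 1 := by
  rw [poly_norm_def, map_one]; exact ContinuousLinearMap.norm_id_le

lemma abs_polyEval_le {g : ℕ → ℝ} {K : ℝ} (hg : ∀ k, |g k| ≤ K) (P : ℝ[X]) :
    |polyEval g P| ≤ K * ‖P‖ := by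
  have hK : 0 ≤ K := (abs_nonneg _).trans (hg 0)
  set G : ℕ →ᵇ ℝ := BoundedContinuousFunction.ofNormedAddCommGroupDiscrete g K hg with hG
  have hnG : ‖G‖ ≤ K := (BoundedContinuousFunction.norm_le hK).2 hg
  have e : polyEval g P = (aeval shiftCLM P) G 0 := by
    induction P using Polynomial.induction_on' with
    | add P Q hP hQ => rw [map_add, map_add, hP, hQ]; rfl
    | monomial k c =>
      rw [polyEval_monomial, aeval_monomial, ← Algebra.smul_def]
      change g k * c = c * ((shiftCLM ^ k) G 0)
      rw [shiftCLM_pow_apply, zero_add, mul_comm]; rfl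
  rw [e, ← Real.norm_eq_abs, poly_norm_def, mul_comm]
  exact ((aeval shiftCLM P G).norm_coe_le_norm 0).trans
    ((ContinuousLinearMap.le_opNorm _ _).trans (by gcongr))

end Functional

section SteinFunctional

attribute [local instance] polySeminormedCommRing polyNormedAlgebra

variable {α β : ℝ}

/-- The derivative of the generating function of the sum, by the position of the marked visit. -/
lemma derivative_genStat (hα : α ∈ Set.Ioo (0 : ℝ) 1) (hβ : β ∈ Set.Ioo (0 : ℝ) 1) (N : ℕ) :
    derivative (genStat α β (X : ℝ[X]) N) = ∑ u ∈ Finset.range (N + 1),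
      C (p α β) * (genOne α β X u * genOne α β X (N - u)) := by
  have h := map_detailed_balance (𝔸 := ℝ[X]) hα hβ
  simp only [algebraMap_eq] at h
  -- the derivative of the future only, given the past
  have key : ∀ k j : ℕ, C (p α β) * X * (genOne α β X j * derivative (genOne α β X k)) +
      C (1 - p α β) * (genZero α β X j * derivative (genZero α β X k)) =
      ∑ u ∈ Finset.range k, C (p α β) * (genOne α β X (j + 1 + u) * genOne α β X (k - 1 - u)) := by
    intro k
    induction k with
    | zero => intro j; simp [genOne, genZero]
    | succ k ih =>
      intro j
      rw [Finset.sum_range_succ']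
      have h1 : ∀ u ∈ Finset.range k, C (p α β) *
          (genOne α β X (j + 1 + (u + 1)) * genOne α β X (k + 1 - 1 - (u + 1))) =
          C (p α β) * (genOne α β X (j + 1 + 1 + u) * genOne α β X (k - 1 - u)) := by
        intro u _
        rw [show j + 1 + (u + 1) = j + 1 + 1 + u by ring,
          show k + 1 - 1 - (u + 1) = k - 1 - u by omega]
      rw [Finset.sum_congr rfl h1, ← ih (j + 1), genOne_succ, genZero_succ, genOne_succ,
        genZero_succ]
      simp only [algebraMap_eq, derivative_add, derivative_mul, derivative_C, derivative_X,
        Nat.add_sub_cancel, Nat.sub_zero, zero_mul, zero_add, mul_one]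
      linear_combination (genZero α β X j * genOne α β X k +
        X * genZero α β X j * derivative (genOne α β X k) -
        X * genOne α β X j * derivative (genZero α β X k)) * h
  have h0 := key N 0
  unfold genStat
  simp only [algebraMap_eq, derivative_add, derivative_mul, derivative_C, derivative_X]
  rw [Finset.sum_range_succ']
  have h1 : ∀ u ∈ Finset.range N, C (p α β) * (genOne α β X (u + 1) * genOne α β X (N - (u + 1))) =
      C (p α β) * (genOne α β X (0 + 1 + u) * genOne α β X (N - 1 - u)) := by
    intro u _
    rw [show 0 + 1 + u = u + 1 by ring, show N - 1 - u = N - (u + 1) by omega]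
  rw [Finset.sum_congr rfl h1, ← h0]
  simp only [genOne, genZero, chainIter_zero, Nat.sub_zero]
  ring

/-- The constant in front of the main term of `defect` in the Stein functional. -/
noncomputable def steinConst (α β b : ℝ) : ℝ := ((1 - b) * p α β + b) / ((1 - b) * (1 - p α β))

/-- The generating function against which the second differences of the Stein solution are
integrated. -/
noncomputable def steinRemainder (α β b : ℝ) (N : ℕ) : ℝ[X] :=
  C (p α β * ((1 - b) * (1 - p α β))) * defect α β X (steinConst α β b) N

/-- The expected Stein operator only involves increments of `g`. -/
lemma polyEval_stein_genStat (hα : α ∈ Set.Ioo (0 : ℝ) 1) (hβ : β ∈ Set.Ioo (0 : ℝ) 1) (N : ℕ)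
    {b : ℝ} (hb : b < 1) (g : ℕ → ℝ) :
    polyEval (fun k => ((1 - b) * ((N + 1) * p α β) + b * k) * g (k + 1) - k * g k)
        (genStat α β X N) =
      polyEval (fun k => g (k + 2) - g (k + 1)) (steinRemainder α β b N) := by
  have hb' : 1 - b ≠ 0 := by linarith
  have hp' : 1 - p α β ≠ 0 := by linarith [p_lt_one hα hβ]
  have e : C ((1 - b) * ((N + 1) * p α β)) * genStat α β X N +
      C b * X * derivative (genStat α β X N) - derivative (genStat α β X N) =
        (X - 1) * steinRemainder α β b N := by
    have hF : C ((1 - b) * ((N + 1) * p α β)) * genStat α β X N =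
        ∑ u ∈ Finset.range (N + 1), C ((1 - b) * p α β) * genStat α β X N := by
      rw [Finset.sum_const, Finset.card_range, nsmul_eq_mul]
      simp only [map_mul, map_add, map_one, map_natCast]
      push_cast; ring
    rw [derivative_genStat hα hβ, hF, steinRemainder, defect, Finset.mul_sum, Finset.mul_sum,
      Finset.mul_sum, ← Finset.sum_add_distrib, ← Finset.sum_sub_distrib]
    refine Finset.sum_congr rfl fun u hu => ?_
    have hu' : u + (N - u) = N := by have := Finset.mem_range.1 hu; omega
    have h := genStat_sub' (T := (X : ℝ[X])) hα hβ u (N - u)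
    rw [hu'] at h
    have hc : C (p α β * ((1 - b) * (1 - p α β))) * C (steinConst α β b) =
        C (p α β) * ((1 - C b) * C (p α β) + C b) := by
      rw [← C_1, ← C_sub, ← C_mul, ← C_mul, ← C_add, ← C_mul]
      congr 1
      unfold steinConst
      field_simp
    simp only [algebraMap_eq, map_mul, map_sub, map_one] at h hc ⊢
    linear_combination (1 - C b) * C (p α β) * h -
      (X - 1) * (genOne α β X u * genOne α β X (N - u)) * hc
  rw [polyEval_stein, e, polyEval_X_mul, sub_mul, one_mul, map_sub, polyEval_X_mul,
    polyEval_sub_left]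

lemma eval_one_gen (k : ℕ) :
    (genOne α β (X : ℝ[X]) k).eval 1 = 1 ∧ (genZero α β (X : ℝ[X]) k).eval 1 = 1 := by
  induction k with
  | zero => simp [genOne, genZero]
  | succ k ih =>
    rw [genOne_succ, genZero_succ]
    simp [algebraMap_eq, ih.1, ih.2]

lemma eval_one_genDiff (k : ℕ) : (genDiff α β (X : ℝ[X]) k).eval 1 = geomSum α β k := by
  induction k with
  | zero => simp [genDiff, geomSum]
  | succ k ih =>
    rw [genDiff, geomSum_succ]
    simp [algebraMap_eq, ih, (eval_one_gen k).1]

lemma eval_one_defect (c : ℝ) (N : ℕ) :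
    (defect α β (X : ℝ[X]) c N).eval 1 = (N + 1) * (c - 2 * (β - α) * avgGeom α β N) := by
  have hN : (N : ℝ) + 1 ≠ 0 := by positivity
  have hrefl : ∑ u ∈ Finset.range (N + 1), geomSum α β (N - u) =
      ∑ u ∈ Finset.range (N + 1), geomSum α β u := by
    rw [← Finset.sum_range_reflect (fun u => geomSum α β u)]
    exact Finset.sum_congr rfl fun u _ => by rw [Nat.add_sub_cancel]
  have hs : (N + 1) * avgGeom α β N = ∑ u ∈ Finset.range (N + 1), geomSum α β u := by
    unfold avgGeom; field_simp
  have e : (defect α β (X : ℝ[X]) c N).eval 1 = ∑ u ∈ Finset.range (N + 1),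
      (c - (β - α) * (geomSum α β u + geomSum α β (N - u))) := by
    unfold defect
    rw [eval_finsetSum]
    refine Finset.sum_congr rfl fun u _ => ?_
    simp [algebraMap_eq, (eval_one_gen _).1, eval_one_genDiff]
  rw [e, Finset.sum_sub_distrib, ← Finset.mul_sum, Finset.sum_add_distrib, hrefl, ← hs,
    Finset.sum_const, Finset.card_range, nsmul_eq_mul]
  push_cast; ring

/-- The main term of the final bound: the smoothed defect per unit of time. -/
noncomputable def defectBound (α β : ℝ) (n : ℕ) : ℝ :=
  9 * max α β * |β - α| / (1 - |β - α|) ^ 2 * smoothScale α β n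

lemma norm_steinRemainder_le (hα : α ∈ Set.Ioo (0 : ℝ) 1) (hβ : β ∈ Set.Ioo (0 : ℝ) 1) (N : ℕ)
    {b : ℝ} (hb : b < 1) :
    ‖steinRemainder α β b N‖ ≤ |(steinRemainder α β b N).eval 1| +
      (N + 1) * p α β * ((1 - b) * (1 - p α β)) * defectBound α β (N + 1) := by
  have hp0 := p_pos hα hβ
  have hp1 := p_lt_one hα hβ
  set c := p α β * ((1 - b) * (1 - p α β)) with hc
  have hc0 : 0 < c := mul_pos hp0 (mul_pos (by linarith) (by linarith))
  set κ := 2 * (β - α) * avgGeom α β N with hκ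
  have e : defect α β (X : ℝ[X]) (steinConst α β b) N = defect α β X κ N +
      algebraMap ℝ ℝ[X] (steinConst α β b - κ) *
        ∑ u ∈ Finset.range (N + 1), genOne α β X u * genOne α β X (N - u) := by
    unfold defect
    rw [Finset.mul_sum, ← Finset.sum_add_distrib]
    refine Finset.sum_congr rfl fun u _ => ?_
    simp only [map_sub]; ring
  have hsum : ‖∑ u ∈ Finset.range (N + 1), genOne α β (X : ℝ[X]) u * genOne α β X (N - u)‖ ≤
      (N + 1 : ℝ) := by
    refine (norm_sum_le _ _).trans ((Finset.sum_le_card_nsmul _ _ 1 fun u _ => ?_).trans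
      (le_of_eq ?_))
    · have s := (isSmoothSeq_chainIter norm_poly_one_le norm_poly_X_le hα hβ 0).1
      exact (norm_mul_le_of_le_one (s u).1).trans (s (N - u)).1
    · rw [Finset.card_range, nsmul_eq_mul]; push_cast; ring
  have hval : (steinRemainder α β b N).eval 1 = c * ((N + 1) * (steinConst α β b - κ)) := by
    rw [steinRemainder, eval_mul, eval_C, eval_one_defect]
  rw [hval, steinRemainder, ← algebraMap_eq, norm_algebraMap_mul, ← hc, abs_of_pos hc0, e]
  have h1 := norm_defect_le norm_poly_one_le norm_poly_X_le hα hβ N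
  rw [← hκ] at h1
  have h2 := norm_algebraMap_mul (steinConst α β b - κ)
    (∑ u ∈ Finset.range (N + 1), genOne α β (X : ℝ[X]) u * genOne α β X (N - u))
  have h3 := norm_add_le (defect α β (X : ℝ[X]) κ N)
    (algebraMap ℝ ℝ[X] (steinConst α β b - κ) *
      ∑ u ∈ Finset.range (N + 1), genOne α β X u * genOne α β X (N - u))
  rw [h2] at h3
  have hN : (0 : ℝ) < N + 1 := by positivity
  rw [abs_mul c, abs_mul ((N : ℝ) + 1), abs_of_pos hc0, abs_of_pos hN]
  have h4 := mul_le_mul_of_nonneg_left hsum (abs_nonneg (steinConst α β b - κ))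
  calc _ ≤ c * ((N + 1) * defectBound α β (N + 1) + |steinConst α β b - κ| * (N + 1)) := by
        gcongr
        exact h3.trans (add_le_add h1 h4)
    _ = _ := by rw [hc]; ring

/-- **The expected Stein operator is small** for test functions with bounded increments. -/
lemma abs_polyEval_stein_le (hα : α ∈ Set.Ioo (0 : ℝ) 1) (hβ : β ∈ Set.Ioo (0 : ℝ) 1) (N : ℕ)
    {b : ℝ} (hb : b < 1) {g : ℕ → ℝ} {K : ℝ} (hg : ∀ k, 1 ≤ k → |g (k + 1) - g k| ≤ K) :
    |polyEval (fun k => ((1 - b) * ((N + 1) * p α β) + b * k) * g (k + 1) - k * g k)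
        (genStat α β X N)| ≤ K * (|(steinRemainder α β b N).eval 1| +
      (N + 1) * p α β * ((1 - b) * (1 - p α β)) * defectBound α β (N + 1)) := by
  rw [polyEval_stein_genStat hα hβ N hb]
  have hK : 0 ≤ K := (abs_nonneg _).trans (hg 1 le_rfl)
  exact (abs_polyEval_le (fun k => hg (k + 1) (by omega)) _).trans
    (mul_le_mul_of_nonneg_left (norm_steinRemainder_le hα hβ N hb) hK)

end SteinFunctional

end MarkovBinomial

/-! ### The law of the chain sum -/

namespace MarkovBinomial

section Law

lemma chainSum_le {Ω : Type*} {n : ℕ} {X : ℕ → Ω → Fin 2} (ω : Ω) : chainSum n X ω ≤ n := by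
  unfold chainSum
  refine (Finset.sum_le_card_nsmul _ _ 1 fun i _ => by omega).trans ?_
  simp

variable {Ω : Type*} [MeasurableSpace Ω] {μ : Measure Ω}
  {P : Matrix (Fin 2) (Fin 2) ℝ} {n : ℕ} {X : ℕ → Ω → Fin 2}

lemma IsStationaryMarkovChain.measurable_chainSum (hX : IsStationaryMarkovChain μ P n X) :
    Measurable (chainSum n X) :=
  Finset.measurable_sum _ fun i hi => (measurable_of_finite _).comp (hX.measurable i hi)

lemma IsStationaryMarkovChain.integral_indicator_chainSum
    (hX : IsStationaryMarkovChain μ P n X) (A : Set ℕ) :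
    ∫ ω, A.indicator (fun _ => (1 : ℝ)) (chainSum n X ω) ∂μ = (μ.map (chainSum n X)).real A := by
  have hm := hX.measurable_chainSum
  rw [← integral_map (f := A.indicator fun _ => (1 : ℝ)) hm.aemeasurable
    (measurable_of_countable _).aestronglyMeasurable,
    MeasureTheory.integral_indicator MeasurableSet.of_discrete]
  simp

variable [IsProbabilityMeasure μ]

lemma integral_comp_fintype {E : Type*} [Fintype E] [MeasurableSpace E]
    [MeasurableSingletonClass E] {Y : Ω → E} (hY : Measurable Y) (F : E → ℝ) :
    ∫ ω, F (Y ω) ∂μ = ∑ y, μ.real {ω | Y ω = y} * F y := by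
  have : IsProbabilityMeasure (μ.map Y) := Measure.isProbabilityMeasure_map hY.aemeasurable
  rw [← integral_map hY.aemeasurable (f := F) (measurable_of_finite F).aestronglyMeasurable,
    integral_fintype .of_finite]
  refine Finset.sum_congr rfl fun y _ => ?_
  rw [map_measureReal_apply hY (measurableSet_singleton y), smul_eq_mul]
  rfl

/-- The Markov property, for functions of the sum up to time `k` and of two successive states. -/
lemma IsStationaryMarkovChain.integral_step (hX : IsStationaryMarkovChain μ P n X) {k : ℕ}
    (hk : 1 ≤ k) (hkn : k < n) (H : ℕ → Fin 2 → Fin 2 → ℝ) :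
    ∫ ω, H (chainSum k X ω) (X k ω) (X (k + 1) ω) ∂μ =
      ∫ ω, ∑ j, P (X k ω) j * H (chainSum k X ω) (X k ω) j ∂μ := by
  have hkmem : k ∈ Finset.Icc 1 k := Finset.mem_Icc.2 ⟨hk, le_rfl⟩
  set Φ : Ω → (Finset.Icc 1 k → Fin 2) := fun ω i => X i ω with hΦ
  have hΦm : Measurable Φ := measurable_pi_lambda _ fun i => hX.measurable i
    (Finset.Icc_subset_Icc_right hkn.le i.2)
  have hXm : Measurable (X (k + 1)) := hX.measurable _ (Finset.mem_Icc.2 ⟨by omega, hkn⟩)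
  have hS : ∀ ω, chainSum k X ω = ∑ i, (Φ ω i : ℕ) := fun ω =>
    (Finset.sum_coe_sort (Finset.Icc 1 k) fun i => (X i ω : ℕ)).symm
  have hXk : ∀ ω, X k ω = Φ ω ⟨k, hkmem⟩ := fun ω => rfl
  simp only [hS]
  simp only [hXk]
  rw [integral_comp_fintype (Y := fun ω => (Φ ω, X (k + 1) ω)) (hΦm.prodMk hXm)
      (fun y => H (∑ i, (y.1 i : ℕ)) (y.1 ⟨k, hkmem⟩) y.2),
    integral_comp_fintype hΦm (fun y => ∑ j, P (y ⟨k, hkmem⟩) j *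
      H (∑ i, (y i : ℕ)) (y ⟨k, hkmem⟩) j), Fintype.sum_prod_type]
  refine Finset.sum_congr rfl fun y _ => ?_
  rw [Finset.mul_sum]
  refine Finset.sum_congr rfl fun j _ => ?_
  set x : ℕ → Fin 2 := fun i => if h : i ∈ Finset.Icc 1 k then y ⟨i, h⟩ else j with hx
  have hxi : ∀ i (h : i ∈ Finset.Icc 1 k), x i = y ⟨i, h⟩ := fun i h => dif_pos h
  have hxk : x (k + 1) = j := dif_neg (by simp)
  have h := hX.markov k hk hkn x
  have e1 : {ω | Φ ω = y} = {ω | ∀ i ∈ Finset.Icc 1 k, X i ω = x i} := by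
    ext ω
    simp only [Set.mem_ofPred_eq, hΦ, funext_iff, Subtype.forall]
    exact forall₂_congr fun i hi => by rw [hxi i hi]
  have e2 : {ω | (Φ ω, X (k + 1) ω) = (y, j)} =
      {ω | ∀ i ∈ Finset.Icc 1 (k + 1), X i ω = x i} := by
    have e1' : ∀ ω, Φ ω = y ↔ ∀ i ∈ Finset.Icc 1 k, X i ω = x i := fun ω => by
      rw [Set.ext_iff] at e1; exact e1 ω
    ext ω
    simp only [Set.mem_ofPred_eq, Prod.mk.injEq, e1']
    constructor
    · rintro ⟨h1, h2⟩ i hi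
      rcases eq_or_ne i (k + 1) with rfl | hne
      · rw [h2, hxk]
      · exact h1 i (by simp only [Finset.mem_Icc] at hi ⊢; omega)
    · intro h1
      refine ⟨fun i hi => h1 i (Finset.Icc_subset_Icc_right (Nat.le_succ k) hi), ?_⟩
      rw [h1 (k + 1) (Finset.mem_Icc.2 ⟨by omega, le_rfl⟩), hxk]
  rw [e1, e2, h, hxi k hkmem, hxk]
  ring

variable {α β : ℝ}

lemma IsStationaryMarkovChain.measure_first
    (hX : IsStationaryMarkovChain μ (transitionMatrix α β) n X) (hn : 1 ≤ n)
    (hα : α ∈ Set.Ioo (0 : ℝ) 1) (hβ : β ∈ Set.Ioo (0 : ℝ) 1) :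
    μ.real {ω | X 1 ω = 0} = 1 - p α β ∧ μ.real {ω | X 1 ω = 1} = p α β := by
  have hm : Measurable (X 1) := hX.measurable 1 (Finset.mem_Icc.2 ⟨le_rfl, hn⟩)
  have htot : μ.real {ω | X 1 ω = 0} + μ.real {ω | X 1 ω = 1} = 1 := by
    have := integral_comp_fintype (μ := μ) hm (fun _ => 1)
    simpa [Fin.sum_univ_two] using this.symm
  have hst := congrFun hX.stationary 1
  simp only [Matrix.vecMul, dotProduct, Fin.sum_univ_two, transitionMatrix, Matrix.of_apply,
    Matrix.cons_val_zero, Matrix.cons_val_one, Matrix.cons_val'] at hst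
  have hd : 1 - β + α ≠ 0 := by linarith [hα.1, hβ.2]
  have h1 : μ.real {ω | X 1 ω = 1} = p α β := by
    rw [p, eq_div_iff hd]
    have h0 : μ.real {ω | X 1 ω = 0} = 1 - μ.real {ω | X 1 ω = 1} := by linarith
    rw [h0] at hst
    linarith
  exact ⟨by linarith, h1⟩

/-- The generating function of the next `m` states from the state `j`. -/
noncomputable def genFrom (α β : ℝ) (j : Fin 2) (m : ℕ) : Polynomial ℝ :=
  if j = 0 then genZero α β Polynomial.X m else genOne α β Polynomial.X m

/-- The law of the chain sum is given by its generating function. -/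
lemma IsStationaryMarkovChain.integral_chainSum
    (hX : IsStationaryMarkovChain μ (transitionMatrix α β) n X) (hn : 1 ≤ n)
    (hα : α ∈ Set.Ioo (0 : ℝ) 1) (hβ : β ∈ Set.Ioo (0 : ℝ) 1) (G : ℕ → ℝ) :
    ∫ ω, G (chainSum n X ω) ∂μ = polyEval G (genStat α β Polynomial.X (n - 1)) := by
  -- revealing one more state leaves the expectation of the prediction unchanged
  have key : ∀ k, 1 ≤ k → k ≤ n →
      ∫ ω, polyEval (fun s => G (s + chainSum k X ω)) (genFrom α β (X k ω) (n - k)) ∂μ =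
        polyEval G (genStat α β Polynomial.X (n - 1)) := by
    intro k hk
    induction k, hk using Nat.le_induction with
    | base =>
      intro _
      have hm : Measurable (X 1) := hX.measurable 1 (Finset.mem_Icc.2 ⟨le_rfl, hn⟩)
      have hS : ∀ ω, chainSum 1 X ω = (X 1 ω : ℕ) := fun ω => by simp [chainSum]
      simp only [hS]
      rw [integral_comp_fintype hm (fun j => polyEval (fun s => G (s + (j : ℕ)))
        (genFrom α β j (n - 1))), Fin.sum_univ_two]
      obtain ⟨h0, h1⟩ := hX.measure_first hn hα hβ
      rw [h0, h1, genStat, map_add, mul_assoc, Polynomial.algebraMap_eq, polyEval_C_mul,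
        polyEval_C_mul, polyEval_X_mul]
      simp only [genFrom, if_true, Fin.val_zero, Fin.val_one, add_zero, one_ne_zero, if_false]
      ring
    | succ k hk ih =>
      intro hkn
      rw [← ih (by omega)]
      have hS : ∀ ω, chainSum (k + 1) X ω = chainSum k X ω + (X (k + 1) ω : ℕ) := fun ω => by
        unfold chainSum; rw [Finset.sum_Icc_succ_top (by omega)]
      simp only [hS]
      rw [hX.integral_step hk (by omega) (fun s _ j =>
        polyEval (fun t => G (t + (s + (j : ℕ)))) (genFrom α β j (n - (k + 1))))]
      refine integral_congr_ae (Filter.Eventually.of_forall fun ω => ?_)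
      simp only []
      have hm : n - k = n - (k + 1) + 1 := by omega
      rw [hm, Fin.sum_univ_two]
      have e : ∀ (s : ℕ) (Q : Polynomial ℝ), polyEval (fun t => G (t + (s + 1))) Q =
          polyEval (fun t => G (t + s)) (Polynomial.X * Q) := fun s Q => by
        rw [polyEval_X_mul]; congr 2; funext t; congr 1; ring
      generalize X k ω = i
      fin_cases i
      · simp only [genFrom, transitionMatrix, Matrix.of_apply, Matrix.cons_val_zero,
          Matrix.cons_val_one, Matrix.cons_val', Fin.val_zero, Fin.val_one, add_zero, if_true,
          one_ne_zero, if_false, Fin.zero_eta, Fin.isValue]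
        rw [e, genZero_succ, map_add, mul_assoc (algebraMap _ _ _), Polynomial.algebraMap_eq,
          polyEval_C_mul, polyEval_C_mul]
      · simp only [genFrom, transitionMatrix, Matrix.of_apply, Matrix.cons_val_zero,
          Matrix.cons_val_one, Matrix.cons_val', Fin.val_zero, Fin.val_one, add_zero, if_true,
          one_ne_zero, if_false, Fin.mk_one, Fin.isValue]
        rw [e, genOne_succ, map_add, mul_assoc (algebraMap _ _ _), Polynomial.algebraMap_eq,
          polyEval_C_mul, polyEval_C_mul]
  rw [← key n hn le_rfl]
  refine integral_congr_ae (Filter.Eventually.of_forall fun ω => ?_)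
  have h1 : genFrom α β (X n ω) 0 = Polynomial.monomial 0 1 := by
    unfold genFrom; split_ifs <;> simp [genZero, genOne]
  simp only [Nat.sub_self, h1, polyEval_monomial, zero_add, mul_one]

/-- Every function of the chain sum is integrable, since the sum takes finitely many values. -/
lemma IsStationaryMarkovChain.integrable_comp (hX : IsStationaryMarkovChain μ P n X)
    (G : ℕ → ℝ) : Integrable (fun ω => G (chainSum n X ω)) μ := by
  refine Integrable.of_bound (C := ∑ k ∈ Finset.range (n + 1), |G k|)
    ((measurable_of_countable G).comp hX.measurable_chainSum).aestronglyMeasurable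
    (Filter.Eventually.of_forall fun ω => ?_)
  exact Finset.single_le_sum (f := fun k => |G k|) (fun k _ => abs_nonneg _)
    (Finset.mem_range.2 (Nat.lt_succ_of_le (chainSum_le ω)))

/-- The mean of the chain sum, and its variance through the value at `1` of the remainder in the
Stein identity. Both are the Stein identity, for the test functions `1` and `k`. -/
lemma IsStationaryMarkovChain.mean_variance
    (hX : IsStationaryMarkovChain μ (transitionMatrix α β) n X) (hn : 1 ≤ n)
    (hα : α ∈ Set.Ioo (0 : ℝ) 1) (hβ : β ∈ Set.Ioo (0 : ℝ) 1) :
    ∫ ω, (chainSum n X ω : ℝ) ∂μ = n * p α β ∧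
      ∀ b : ℝ, b < 1 → (steinRemainder α β b (n - 1)).eval 1 =
        ∫ ω, (chainSum n X ω : ℝ) ∂μ -
          (1 - b) * variance (fun ω => (chainSum n X ω : ℝ)) μ := by
  have hN : ((n - 1 : ℕ) : ℝ) + 1 = n := by rw [Nat.cast_sub hn]; push_cast; ring
  have hint : ∀ G : ℕ → ℝ, Integrable (fun ω => G (chainSum n X ω)) μ := hX.integrable_comp
  have i1 := hint fun k => (k : ℝ)
  have i2 := hint fun k => (k : ℝ) ^ 2
  have key := fun (b : ℝ) (hb : b < 1) (g : ℕ → ℝ) =>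
    (hX.integral_chainSum hn hα hβ _).trans (polyEval_stein_genStat hα hβ (n - 1) hb g)
  rw [hN] at key
  have mean : ∫ ω, (chainSum n X ω : ℝ) ∂μ = n * p α β := by
    have h := key 0 one_pos fun _ => 1
    simp only [sub_zero, one_mul, zero_mul, add_zero, mul_one, sub_self] at h
    rw [integral_sub (integrable_const _) i1, integral_const, probReal_univ, one_smul] at h
    have : polyEval (fun _ => 0) (steinRemainder α β 0 (n - 1)) = 0 := by
      simpa using polyEval_sub_left (fun _ => 1) (fun _ => 1) (steinRemainder α β 0 (n - 1))
    linarith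
  refine ⟨mean, fun b hb => ?_⟩
  have h := key b hb fun k => (k : ℝ)
  have e : (fun k : ℕ => ((k + 2 : ℕ) : ℝ) - ((k + 1 : ℕ) : ℝ)) = fun _ => 1 := by
    funext k; push_cast; ring
  rw [e, polyEval_one] at h
  have hvar : variance (fun ω => (chainSum n X ω : ℝ)) μ =
      ∫ ω, (chainSum n X ω : ℝ) ^ 2 ∂μ - (∫ ω, (chainSum n X ω : ℝ) ∂μ) ^ 2 :=
    variance_eq_sub ((memLp_two_iff_integrable_sq i1.aestronglyMeasurable).2 i2)
  rw [← h, hvar]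
  have e2 : (fun ω => ((1 - b) * (n * p α β) + b * (chainSum n X ω : ℝ)) *
      ((chainSum n X ω + 1 : ℕ) : ℝ) - (chainSum n X ω : ℝ) * (chainSum n X ω : ℝ)) =
      fun ω => (1 - b) * (n * p α β) + ((1 - b) * (n * p α β) + b) * (chainSum n X ω : ℝ) -
        (1 - b) * (chainSum n X ω : ℝ) ^ 2 := by
    funext ω; push_cast; ring
  have i3 := hint fun k => (1 - b) * (n * p α β) + ((1 - b) * (n * p α β) + b) * (k : ℝ)
  rw [e2, integral_sub i3 (i2.const_mul _), integral_add (integrable_const _) (i1.const_mul _),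
    integral_const, probReal_univ, one_smul, integral_const_mul, integral_const_mul, mean]
  ring

end Law

end MarkovBinomial

/-! ### Total variation approximation -/

namespace MarkovBinomial

section Distance

lemma dTV_le {P Q : Measure ℕ} {B : ℝ} (h : ∀ A : Set ℕ, |P.real A - Q.real A| ≤ B) :
    dTV P Q ≤ B := ciSup_le h

lemma hasSum_indicator_mul_real (Q : Measure ℕ) [IsProbabilityMeasure Q] (A : Set ℕ) :
    HasSum (fun k => A.indicator (fun _ => (1 : ℝ)) k * Q.real {k}) (Q.real A) := by
  have h1 := Measure.tsum_indicator_apply_singleton Q A (MeasurableSet.of_discrete)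
  have h2 : ∑' k, A.indicator (fun x => Q {x}) k ≠ ⊤ := by rw [h1]; exact measure_ne_top Q A
  have h3 := ENNReal.hasSum_toReal h2
  rw [← ENNReal.tsum_toReal_eq (fun k => ENNReal.ne_top_of_tsum_ne_top h2 k), h1] at h3
  convert h3 using 2 with k
  · by_cases hk : k ∈ A <;> simp [hk, Measure.real]
  · rfl

lemma hasSum_real_singleton (Q : Measure ℕ) [IsProbabilityMeasure Q] :
    HasSum (fun k => Q.real {k}) 1 := by
  simpa using hasSum_indicator_mul_real Q Set.univ

end Distance

section Approximation

variable {Ω : Type*} [MeasurableSpace Ω] {μ : Measure Ω} [IsProbabilityMeasure μ] {n : ℕ}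
  {X : ℕ → Ω → Fin 2} {α β : ℝ}

/-- The bound on the expected Stein operator, in terms of the mean and the variance. -/
lemma IsStationaryMarkovChain.abs_integral_stein_le
    (hX : IsStationaryMarkovChain μ (transitionMatrix α β) n X) (hn : 1 ≤ n)
    (hα : α ∈ Set.Ioo (0 : ℝ) 1) (hβ : β ∈ Set.Ioo (0 : ℝ) 1) {b : ℝ} (hb : b < 1) {g : ℕ → ℝ}
    {K : ℝ} (hg : ∀ k, 1 ≤ k → |g (k + 1) - g k| ≤ K) :
    |∫ ω, (((1 - b) * (n * p α β) + b * (chainSum n X ω : ℝ)) * g (chainSum n X ω + 1) -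
        (chainSum n X ω : ℝ) * g (chainSum n X ω)) ∂μ| ≤
      K * (|n * p α β - (1 - b) * variance (fun ω => (chainSum n X ω : ℝ)) μ| +
        n * p α β * ((1 - b) * (1 - p α β)) * defectBound α β n) := by
  have hN : ((n - 1 : ℕ) : ℝ) + 1 = n := by rw [Nat.cast_sub hn]; push_cast; ring
  obtain ⟨h1, h2⟩ := hX.mean_variance hn hα hβ
  have h := abs_polyEval_stein_le hα hβ (n - 1) hb hg
  rw [h2 b hb, h1, hN, Nat.sub_add_cancel hn] at h
  rw [hX.integral_chainSum hn hα hβ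
    (fun k => ((1 - b) * (n * p α β) + b * (k : ℝ)) * g (k + 1) - (k : ℝ) * g k)]
  exact h

/-- Approximation by a distribution whose birth rates `a + b k` do not decrease, with matched mean
and variance. -/
lemma IsStationaryMarkovChain.dTV_le_of_birth_rates
    (hX : IsStationaryMarkovChain μ (transitionMatrix α β) n X) (hn : 1 ≤ n)
    (hα : α ∈ Set.Ioo (0 : ℝ) 1) (hβ : β ∈ Set.Ioo (0 : ℝ) 1) {b : ℝ} (hb0 : 0 ≤ b) (hb : b < 1)
    (hvar : n * p α β = (1 - b) * variance (fun ω => (chainSum n X ω : ℝ)) μ)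
    (Q : Measure ℕ) [IsProbabilityMeasure Q] (hQ : ∀ k, 0 < Q.real {k})
    (hrec : ∀ k : ℕ, ((1 - b) * (n * p α β) + b * k) * Q.real {k} = (k + 1) * Q.real {k + 1}) :
    dTV (μ.map (chainSum n X)) Q ≤ (1 - p α β) * defectBound α β n := by
  have hn0 : (0 : ℝ) < n := by exact_mod_cast hn
  have hp0 := p_pos hα hβ
  have hb1 : 0 < 1 - b := by linarith
  refine dTV_le fun A => ?_
  set a := (1 - b) * (n * p α β) with ha
  have ha0 : 0 < a := by positivity
  set χ : ℕ → ℝ := A.indicator fun _ => 1 with hχ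
  have hχ0 : ∀ i, 0 ≤ χ i := fun i => Set.indicator_nonneg (fun _ _ => zero_le_one) i
  have hχ1 : ∀ i, χ i ≤ 1 := fun i => Set.indicator_le_self' (fun _ _ => zero_le_one) i
  set g := steinSol (fun k => Q.real {k}) χ (Q.real A) with hg
  have hinc : ∀ k, 1 ≤ k → |g (k + 1) - g k| ≤ a⁻¹ := by
    intro k hk
    have hak : 0 < a + b * k := by positivity
    refine (abs_steinSol_sub_le ha0.le hb.le (fun i => (hQ i).le) (hasSum_real_singleton Q) hrec
      hχ0 hχ1 (hasSum_indicator_mul_real Q A) hk (hQ k) hak).trans ((min_le_left _ _).trans ?_)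
    have : 0 ≤ b * k := by positivity
    gcongr
    linarith
  have h := hX.abs_integral_stein_le hn hα hβ hb hinc
  have e : ∀ ω, (a + b * (chainSum n X ω : ℝ)) * g (chainSum n X ω + 1) -
      (chainSum n X ω : ℝ) * g (chainSum n X ω) = χ (chainSum n X ω) - Q.real A := fun ω =>
    steinSol_spec (hrec _) (hQ _) (hQ _)
  simp only [← ha, e] at h
  rw [integral_sub (hX.integrable_comp χ) (integrable_const _), integral_const, probReal_univ,
    one_smul, hX.integral_indicator_chainSum, ← hvar, sub_self, abs_zero, zero_add] at h
  refine h.trans (le_of_eq ?_)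
  rw [ha]
  field_simp

/-- Approximation by a binomial distribution with matched mean. The Stein solution is continued
beyond `m` by a constant, which makes the Stein equation an inequality there. This bounds
`Q A - P A` for `A ⊆ {0, …, m}`, where `Q` is the binomial law and `P` that of the chain sum; as `Q` lives
on `{0, …, m}`, all test sets follow by restriction and complementation. -/
lemma IsStationaryMarkovChain.dTV_binomial_le
    (hX : IsStationaryMarkovChain μ (transitionMatrix α β) n X) (hn : 1 ≤ n)
    (hα : α ∈ Set.Ioo (0 : ℝ) 1) (hβ : β ∈ Set.Ioo (0 : ℝ) 1) {m : ℕ} (hm : 1 ≤ m)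
    (θ : unitInterval) (hθ : n * p α β = m * θ) (hθ1 : (θ : ℝ) < 1) :
    dTV (μ.map (chainSum n X)) (binomial m θ) ≤ (n * p α β)⁻¹ *
      (|n * p α β - (1 - (θ : ℝ))⁻¹ * variance (fun ω => (chainSum n X ω : ℝ)) μ| +
        n * p α β * ((1 - (θ : ℝ))⁻¹ * (1 - p α β)) * defectBound α β n) := by
  have hn0 : (0 : ℝ) < n := by exact_mod_cast hn
  have hm0 : (0 : ℝ) < m := by exact_mod_cast hm
  have hp0 := p_pos hα hβ
  have hnp : 0 < n * p α β := by positivity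
  set t : ℝ := (θ : ℝ) with ht
  have ht0 : 0 < t := by
    rw [hθ] at hnp; exact pos_of_mul_pos_right hnp hm0.le
  have hd : 0 < 1 - t := by linarith
  set b : ℝ := -(t / (1 - t)) with hbdef
  have hb1 : 1 - b = (1 - t)⁻¹ := by rw [hbdef]; field_simp; ring
  have hb0 : b ≤ 0 := by rw [hbdef]; exact neg_nonpos.2 (by positivity)
  have hb : b < 1 := by linarith
  set a := (1 - b) * (n * p α β) with ha
  have hrate : ∀ x : ℝ, a + b * x = t * (m - x) / (1 - t) := fun x => by
    rw [ha, hb1, hθ, hbdef]; field_simp; ring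
  have ha0 : 0 ≤ a := by rw [ha]; exact mul_nonneg (by linarith) hnp.le
  set Q := binomial m θ with hQ
  set w : ℕ → ℝ := fun k => Q.real {k} with hw
  have hwk : ∀ k, w k = m.choose k * t ^ k * (1 - t) ^ (m - k) := fun k =>
    binomial_real_singleton m k θ
  have hwpos : ∀ k, k ≤ m → 0 < w k := fun k hk => by
    rw [hwk]
    have : (0 : ℝ) < m.choose k := by exact_mod_cast Nat.choose_pos hk
    positivity
  have hwzero : ∀ k, m < k → w k = 0 := fun k hk => by
    rw [hwk, Nat.choose_eq_zero_of_lt hk]; simp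
  have hw0 : ∀ k, 0 ≤ w k := fun k => measureReal_nonneg
  have hrec : ∀ k : ℕ, (a + b * k) * w k = (k + 1) * w (k + 1) := by
    intro k
    rw [hrate]
    rcases lt_trichotomy k m with hk | rfl | hk
    · rw [hwk, hwk]
      have h := congrArg (Nat.cast (R := ℝ)) (Nat.choose_succ_right_eq m k)
      push_cast [Nat.cast_sub hk.le] at h
      obtain ⟨j, hj⟩ := Nat.exists_eq_add_of_lt hk
      rw [show m - k = j + 1 by omega, show m - (k + 1) = j by omega, pow_succ, pow_succ]
      field_simp
      linear_combination -h
    · rw [hwzero (k + 1) (by omega)]; simp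
    · rw [hwzero k hk, hwzero (k + 1) (by omega)]; simp
  have hsum : HasSum w 1 := hasSum_real_singleton Q
  -- one half of the bound, for test sets inside `{0, …, m}`
  have half : ∀ A : Set ℕ, A ⊆ Set.Iic m → Q.real A - (μ.map (chainSum n X)).real A ≤
      (n * p α β)⁻¹ * (|n * p α β -
        (1 - b) * variance (fun ω => (chainSum n X ω : ℝ)) μ| +
        n * p α β * ((1 - b) * (1 - p α β)) * defectBound α β n) := by
    intro A hA
    set χ : ℕ → ℝ := A.indicator fun _ => 1 with hχ
    have hχ0 : ∀ i, 0 ≤ χ i := fun i => Set.indicator_nonneg (fun _ _ => zero_le_one) i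
    have hχ1 : ∀ i, χ i ≤ 1 := fun i => Set.indicator_le_self' (fun _ _ => zero_le_one) i
    have hχm : ∀ i, m < i → χ i = 0 := fun i hi =>
      Set.indicator_of_notMem (fun h => absurd (hA h) (by simpa using hi)) _
    set q := Q.real A with hq
    have hq0 : 0 ≤ q := measureReal_nonneg
    have hqsum : HasSum (fun k => χ k * w k) q := hasSum_indicator_mul_real Q A
    set g : ℕ → ℝ := fun i => if i ≤ m then steinSol w χ q i else q / m with hg
    have hgm : g m = (q - χ m) / m := by
      have s1 : ∑ j ∈ Finset.range (m + 1), w j = 1 :=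
        (hasSum_sum_of_ne_finset_zero fun k hk =>
          hwzero k (by simpa using hk)).unique hsum
      have s2 : ∑ j ∈ Finset.range (m + 1), χ j * w j = q :=
        (hasSum_sum_of_ne_finset_zero fun k hk => by
          rw [hwzero k (by simpa using hk), mul_zero]).unique hqsum
      rw [Finset.sum_range_succ] at s1 s2
      have hwm := hwpos m le_rfl
      simp only [hg, le_refl, if_true, steinSol]
      rw [eq_sub_of_add_eq s1, eq_sub_of_add_eq s2]
      field_simp
      ring
    have hinc : ∀ k, 1 ≤ k → |g (k + 1) - g k| ≤ (n * p α β)⁻¹ := by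
      intro k hk
      have hk0 : (0 : ℝ) < k := by exact_mod_cast hk
      rw [hθ]
      rcases lt_trichotomy k m with hkm | rfl | hkm
      · have hkm' : (k : ℝ) < m := by exact_mod_cast hkm
        have hpos : 0 < a + b * k := by
          rw [hrate]; exact div_pos (mul_pos ht0 (by linarith)) hd
        have h := abs_steinSol_sub_le ha0 hb.le hw0 hsum hrec hχ0 hχ1 hqsum hk
          (hwpos k hkm.le) hpos
        simp only [hg, hkm.le, Nat.succ_le_of_lt hkm, if_true]
        -- below the mean the birth rate is the larger of the two rates, above it the death rate
        rcases le_total (m * t) k with hmean | hmean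
        · exact h.trans ((min_le_right _ _).trans (by gcongr))
        · refine h.trans ((min_le_left _ _).trans ?_)
          gcongr
          rw [hrate, le_div_iff₀ hd]
          nlinarith
      · rw [hgm]
        simp only [hg, Nat.not_succ_le_self, if_false]
        have e : q / (k : ℝ) - (q - χ k) / k = χ k / k := by ring
        rw [e, abs_of_nonneg (div_nonneg (hχ0 _) hk0.le), ← one_div]
        exact div_le_div₀ zero_le_one (hχ1 _) (by positivity)
          (mul_le_of_le_one_right hk0.le hθ1.le)
      · simp only [hg, not_le.2 hkm, not_le.2 (hkm.trans (Nat.lt_succ_self k)), if_false]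
        rw [sub_self, abs_zero]; positivity
    have hG : ∀ k : ℕ, (a + b * k) * g (k + 1) - k * g k ≤ χ k - q := by
      intro k
      rcases lt_trichotomy k m with hkm | rfl | hkm
      · simp only [hg, hkm.le, Nat.succ_le_of_lt hkm, if_true]
        exact (steinSol_spec (hrec k) (hwpos k hkm.le) (hwpos _ hkm)).le
      · rw [hgm, hrate]
        refine le_of_eq ?_
        field_simp
        ring
      · have hkm' : (m : ℝ) < k := by exact_mod_cast hkm
        simp only [hg, not_le.2 hkm, not_le.2 (hkm.trans (Nat.lt_succ_self k)), if_false,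
          hχm k hkm, zero_sub]
        have h1 : (a + b * k) * (q / m) ≤ 0 := by
          rw [hrate]
          refine mul_nonpos_of_nonpos_of_nonneg (div_nonpos_of_nonpos_of_nonneg ?_ hd.le)
            (by positivity)
          exact mul_nonpos_of_nonneg_of_nonpos ht0.le (by linarith)
        have h2 : q ≤ k * (q / m) := by
          rw [mul_div_assoc', le_div_iff₀ hm0, mul_comm]; gcongr
        linarith
    have h := hX.abs_integral_stein_le hn hα hβ hb hinc
    have hle : ∫ ω, ((a + b * (chainSum n X ω : ℝ)) * g (chainSum n X ω + 1) -
        (chainSum n X ω : ℝ) * g (chainSum n X ω)) ∂μ ≤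
        ∫ ω, (χ (chainSum n X ω) - q) ∂μ :=
      integral_mono (hX.integrable_comp fun k => (a + b * (k : ℝ)) * g (k + 1) - (k : ℝ) * g k)
        (hX.integrable_comp fun k => χ k - q) fun ω => hG _
    rw [integral_sub (hX.integrable_comp χ) (integrable_const _), integral_const, probReal_univ,
      one_smul, hX.integral_indicator_chainSum] at hle
    have := (abs_le.1 h).1
    rw [← ha] at this
    linarith
  have : IsProbabilityMeasure (μ.map (chainSum n X)) :=
    Measure.isProbabilityMeasure_map hX.measurable_chainSum.aemeasurable
  have full : ∀ A : Set ℕ, Q.real A - (μ.map (chainSum n X)).real A ≤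
      (n * p α β)⁻¹ * (|n * p α β -
        (1 - b) * variance (fun ω => (chainSum n X ω : ℝ)) μ| +
        n * p α β * ((1 - b) * (1 - p α β)) * defectBound α β n) := by
    intro A
    have h1 := half (A ∩ Set.Iic m) Set.inter_subset_right
    have h2 : (μ.map (chainSum n X)).real (A ∩ Set.Iic m) ≤ (μ.map (chainSum n X)).real A :=
      measureReal_mono Set.inter_subset_left
    have h3 : Q.real (A ∩ Set.Iic m) = Q.real A := by
      refine (hasSum_indicator_mul_real Q (A ∩ Set.Iic m)).unique ?_
      convert hasSum_indicator_mul_real Q A using 2 with k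
      rcases le_or_gt k m with hk | hk
      · congr 1
        by_cases hkA : k ∈ A <;> simp [hkA, hk]
      · rw [show Q.real {k} = 0 from hwzero k hk, mul_zero, mul_zero]
    linarith
  rw [← hb1]
  refine dTV_le fun A => abs_le.2 ⟨by linarith [full A], ?_⟩
  have h := full Aᶜ
  rw [probReal_compl_eq_one_sub MeasurableSet.of_discrete,
    probReal_compl_eq_one_sub MeasurableSet.of_discrete] at h
  linarith

end Approximation

end MarkovBinomial

/-! ### Approximating distributions, constants, and the theorem -/

namespace MarkovBinomial

section NegativeBinomial

lemma Gamma_add_div_eq_choose {r : ℝ} (hr : 0 < r) (k : ℕ) :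
    Real.Gamma (r + k) / (Real.Gamma r * (k.factorial : ℝ)) = Ring.choose (r + k - 1) k := by
  have hG : Real.Gamma r ≠ 0 := (Real.Gamma_pos_of_pos hr).ne'
  have h1 : ∀ k : ℕ, Real.Gamma (r + k) = Real.Gamma r * (ascPochhammer ℝ k).eval r := by
    intro k
    induction k with
    | zero => simp
    | succ k ih =>
      have : r + k ≠ 0 := by positivity
      rw [Nat.cast_succ, ← add_assoc, Real.Gamma_add_one this, ih, ascPochhammer_succ_eval]
      ring
  have h2 := Ring.factorial_nsmul_multichoose_eq_ascPochhammer r k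
  rw [Polynomial.ascPochhammer_smeval_eq_eval, nsmul_eq_mul] at h2
  have h3 : Ring.choose (r + k - 1) k = Ring.multichoose r k := by
    rw [Ring.choose]; congr 1; ring
  have hk : (k.factorial : ℝ) ≠ 0 := by positivity
  rw [h3, h1, ← h2]
  field_simp

variable {r q : ℝ}

lemma hasSum_negBinomial (hr : 0 < r) (hq0 : 0 < q) (hq1 : q < 1) :
    HasSum (fun k : ℕ => Real.Gamma (r + k) / (Real.Gamma r * (k.factorial : ℝ)) * q ^ r *
      (1 - q) ^ k) 1 := by
  have h := (Real.one_div_one_sub_rpow_hasFPowerSeriesOnBall_zero r).hasSum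
    (y := 1 - q) (by
      simp only [Metric.mem_eball, edist_zero_right]
      rw [← ofReal_norm, Real.norm_of_nonneg (by linarith), ← ENNReal.ofReal_one]
      exact (ENNReal.ofReal_lt_ofReal_iff one_pos).2 (by linarith))
  have hq : 1 - (0 + (1 - q)) = q := by ring
  simp only [FormalMultilinearSeries.ofScalars_apply_eq, hq] at h
  have hpos : 0 < q ^ r := Real.rpow_pos_of_pos hq0 r
  have h' := h.mul_left (q ^ r)
  rw [mul_one_div_cancel hpos.ne'] at h'
  refine h'.congr_fun fun k => ?_
  rw [Gamma_add_div_eq_choose hr, smul_eq_mul]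
  ring

lemma negBinomial_mass_pos (hr : 0 < r) (hq0 : 0 < q) (hq1 : q < 1) (k : ℕ) :
    0 < Real.Gamma (r + k) / (Real.Gamma r * (k.factorial : ℝ)) * q ^ r * (1 - q) ^ k := by
  have h1 := Real.Gamma_pos_of_pos hr
  have h2 : 0 < Real.Gamma (r + k) := Real.Gamma_pos_of_pos (by positivity)
  have h3 : 0 < 1 - q := by linarith
  have h4 : 0 < q ^ r := Real.rpow_pos_of_pos hq0 r
  positivity

lemma isProbabilityMeasure_negBinomial (hr : 0 < r) (hq0 : 0 < q) (hq1 : q < 1) :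
    IsProbabilityMeasure (negBinomial r q) :=
  (hasSum_negBinomial hr hq0 hq1).isProbabilityMeasure_sum_dirac
    fun k => (negBinomial_mass_pos hr hq0 hq1 k).le

lemma negBinomial_real_singleton (hr : 0 < r) (hq0 : 0 < q) (hq1 : q < 1) (k : ℕ) :
    (negBinomial r q).real {k} =
      Real.Gamma (r + k) / (Real.Gamma r * (k.factorial : ℝ)) * q ^ r * (1 - q) ^ k := by
  rw [Measure.real, negBinomial, Measure.sum_smul_dirac_singleton,
    ENNReal.toReal_ofReal (negBinomial_mass_pos hr hq0 hq1 k).le]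

lemma negBinomial_recursion (hr : 0 < r) (hq0 : 0 < q) (hq1 : q < 1) (k : ℕ) :
    ((1 - q) * r + (1 - q) * k) * (negBinomial r q).real {k} =
      (k + 1) * (negBinomial r q).real {k + 1} := by
  rw [negBinomial_real_singleton hr hq0 hq1, negBinomial_real_singleton hr hq0 hq1]
  have hG := (Real.Gamma_pos_of_pos hr).ne'
  have hrk : r + k ≠ 0 := by positivity
  rw [Nat.cast_succ, ← add_assoc, Real.Gamma_add_one hrk, Nat.factorial_succ, pow_succ]
  push_cast
  have : (k.factorial : ℝ) ≠ 0 := by positivity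
  field_simp

end NegativeBinomial

section Poisson

lemma poissonMeasure_recursion (l : NNReal) (k : ℕ) :
    (l : ℝ) * (poissonMeasure l).real {k} = (k + 1) * (poissonMeasure l).real {k + 1} := by
  rw [poissonMeasure_real_singleton, poissonMeasure_real_singleton, Nat.factorial_succ, pow_succ]
  push_cast
  have : (k.factorial : ℝ) ≠ 0 := by positivity
  field_simp

end Poisson

section Constants

variable {α β : ℝ}

lemma smoothBound_le (hα : α ∈ Set.Ioo (0 : ℝ) 1) (hβ : β ∈ Set.Ioo (0 : ℝ) 1) {n : ℕ}
    (hn : 1 ≤ n) : smoothBound α β (n / 4) ≤ 2 * K₁ α β / √n := by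
  have hn0 : (0 : ℝ) < n := by exact_mod_cast hn
  have h1α : 0 < 1 - α := by linarith [hα.2]
  have h1β : 0 < 1 - β := by linarith [hβ.2]
  have hα0 := hα.1
  have hβ0 := hβ.1
  have hγ : 0 < min (1 - α) (min β (1 / 2)) := lt_min h1α (lt_min hβ0 (by norm_num))
  have hγ' : min (1 - α) (min β (1 / 2)) ≤ min (1 - α) β :=
    min_le_min_left _ (min_le_left _ _)
  have hcyc : μ₁ α + μ₂ β + 2 = α⁻¹ + (1 - β)⁻¹ := by
    unfold μ₁ μ₂; field_simp; ring
  have hcyc0 : 0 < α⁻¹ + (1 - β)⁻¹ := by positivity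
  have h4 : (n : ℝ) ≤ 4 * ((n / 4 : ℕ) + 1) := by
    have : n ≤ 4 * (n / 4 + 1) := by omega
    exact_mod_cast this
  unfold smoothBound K₁
  rw [hcyc]
  set c := α⁻¹ + (1 - β)⁻¹ with hc
  set γ := min (1 - α) (min β (1 / 2)) with hγd
  calc √(c / (min (1 - α) β * ((n / 4 : ℕ) + 1))) ≤ √(4 * (c / γ) / n) := by
        refine Real.sqrt_le_sqrt ?_
        have e : 4 * (c / γ) / n = c / (γ * (n / 4)) := by field_simp
        rw [e]
        gcongr
        linarith
    _ = 2 * √(c / γ) / √n := by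
        rw [Real.sqrt_div (by positivity), Real.sqrt_mul (by norm_num),
          show (4 : ℝ) = 2 ^ 2 by norm_num, Real.sqrt_sq (by norm_num)]
    _ ≤ 2 * (√5 * √(c / γ)) / √n := by
        gcongr
        exact le_mul_of_one_le_left (Real.sqrt_nonneg _) (Real.one_le_sqrt.2 (by norm_num))

lemma K₂_nonneg (hα : α ∈ Set.Ioo (0 : ℝ) 1) (hβ : β ∈ Set.Ioo (0 : ℝ) 1) : 0 ≤ K₂ α β := by
  have h1α : 0 < 1 - α := by linarith [hα.2]
  have h1β : 0 < 1 - β := by linarith [hβ.2]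
  have hα0 := hα.1
  have hβ0 := hβ.1
  unfold K₂ σ₁sq σ₂sq μ₁ μ₂
  positivity

/-- The smoothed defect, in terms of the constants of the theorem. -/
lemma defectBound_le (hα : α ∈ Set.Ioo (0 : ℝ) 1) (hβ : β ∈ Set.Ioo (0 : ℝ) 1) {n : ℕ}
    (hn : 1 ≤ n) : defectBound α β n ≤ |β - α| * (18 * max α β) / (1 - max α β) ^ 2 *
      (2 * K₁ α β / √n + 4 * K₂ α β / n + max α β ^ (n / 4)) := by
  have hM1 : max α β < 1 := max_lt hα.2 hβ.2
  have hM0 : 0 < max α β := lt_max_of_lt_left hα.1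
  have hr := abs_sub_le_max hα hβ
  have hr0 := abs_nonneg (β - α)
  have hd : 0 < 1 - max α β := by linarith
  have hs := smoothBound_le hα hβ hn
  have hK := K₂_nonneg hα hβ
  have hpow : |β - α| ^ (n / 4) ≤ max α β ^ (n / 4) := by gcongr
  have hs0 := smoothBound_nonneg (α := α) (β := β) (n / 4)
  have hKn : 0 ≤ 4 * K₂ α β / n := by positivity
  unfold defectBound smoothScale
  calc 9 * max α β * |β - α| / (1 - |β - α|) ^ 2 *
        (2 * (smoothBound α β (n / 4) + |β - α| ^ (n / 4)))
      ≤ 9 * max α β * |β - α| / (1 - max α β) ^ 2 *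
        (2 * (2 * K₁ α β / √n + 4 * K₂ α β / n + max α β ^ (n / 4))) := by
        gcongr
        linarith
    _ = _ := by ring

lemma bracket_nonneg (hα : α ∈ Set.Ioo (0 : ℝ) 1) (hβ : β ∈ Set.Ioo (0 : ℝ) 1) (n : ℕ) :
    0 ≤ 2 * K₁ α β / √n + 4 * K₂ α β / n + max α β ^ (n / 4) := by
  have hK := K₂_nonneg hα hβ
  have hM0 : 0 < max α β := lt_max_of_lt_left hα.1
  have hK₁ : 0 ≤ K₁ α β := by unfold K₁; positivity
  positivity

end Constants

section Main

variable {Ω : Type*} [MeasurableSpace Ω] {μ : Measure Ω} [IsProbabilityMeasure μ] {n : ℕ}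
  {X : ℕ → Ω → Fin 2} {α β : ℝ}

/-- Over-dispersion forces positive correlation of successive states. -/
lemma IsStationaryMarkovChain.lt_of_mean_le_variance
    (hX : IsStationaryMarkovChain μ (transitionMatrix α β) n X) (hn : 1 ≤ n)
    (hα : α ∈ Set.Ioo (0 : ℝ) 1) (hβ : β ∈ Set.Ioo (0 : ℝ) 1)
    (h : ∫ ω, (chainSum n X ω : ℝ) ∂μ ≤ variance (fun ω => (chainSum n X ω : ℝ)) μ) : α < β := by
  by_contra hab
  have hp0 := p_pos hα hβ
  have hp1 : 0 < 1 - p α β := by linarith [p_lt_one hα hβ]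
  have hn0 : (0 : ℝ) < n := by exact_mod_cast hn
  have hN : ((n - 1 : ℕ) : ℝ) + 1 = n := by rw [Nat.cast_sub hn]; push_cast; ring
  have h1 := (hX.mean_variance hn hα hβ).2 0 one_pos
  rw [steinRemainder, Polynomial.eval_mul, Polynomial.eval_C, eval_one_defect, hN] at h1
  have h2 : 0 < steinConst α β 0 := by
    unfold steinConst
    simp only [sub_zero, one_mul, add_zero]
    positivity
  have h3 := avgGeom_nonneg hα hβ (n - 1)
  have h4 : 2 * (β - α) * avgGeom α β (n - 1) ≤ 0 :=
    mul_nonpos_of_nonpos_of_nonneg (by linarith) h3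
  have h5 : 0 < p α β * ((1 - 0) * (1 - p α β)) *
      (n * (steinConst α β 0 - 2 * (β - α) * avgGeom α β (n - 1))) := by
    rw [sub_zero, one_mul]
    have : 0 < steinConst α β 0 - 2 * (β - α) * avgGeom α β (n - 1) := by linarith
    positivity
  linarith

/-- Since the sum is a natural number, its second moment is at least its mean. -/
lemma IsStationaryMarkovChain.mean_le_second_moment
    (hX : IsStationaryMarkovChain μ (transitionMatrix α β) n X) :
    ∫ ω, (chainSum n X ω : ℝ) ∂μ ≤ variance (fun ω => (chainSum n X ω : ℝ)) μ +
      (∫ ω, (chainSum n X ω : ℝ) ∂μ) ^ 2 := by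
  have hint : ∀ G : ℕ → ℝ, Integrable (fun ω => G (chainSum n X ω)) μ := hX.integrable_comp
  have i1 := hint fun k => (k : ℝ)
  have i2 := hint fun k => (k : ℝ) ^ 2
  rw [variance_eq_sub ((memLp_two_iff_integrable_sq i1.aestronglyMeasurable).2 i2),
    sub_add_cancel]
  refine integral_mono i1 i2 fun ω => ?_
  have : chainSum n X ω ≤ chainSum n X ω ^ 2 := Nat.le_self_pow (by norm_num) _
  change (chainSum n X ω : ℝ) ≤ (chainSum n X ω : ℝ) ^ 2
  exact_mod_cast this

/-- The bound for the approximations with birth rates that do not decrease, in terms of the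
constants of the theorem. -/
lemma defectBound_le_C₀ (hα : α ∈ Set.Ioo (0 : ℝ) 1) (hβ : β ∈ Set.Ioo (0 : ℝ) 1) (hn : 1 ≤ n)
    (hab : α < β) : (1 - p α β) * defectBound α β n ≤
      C₀ α β * (2 * K₁ α β / √n + 4 * K₂ α β / n + β ^ (n / 4)) := by
  have h := defectBound_le hα hβ hn
  have hB := bracket_nonneg hα hβ n
  have hp0 := p_pos hα hβ
  have hp1 := p_lt_one hα hβ
  have hmax : max α β = β := max_eq_right hab.le
  unfold C₀
  rw [hmax] at h hB ⊢
  have hd : 0 < 1 - β := by linarith [hβ.2]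
  have hβ0 := hβ.1
  set B := 2 * K₁ α β / √n + 4 * K₂ α β / n + β ^ (n / 4) with hBdef
  have hD : 0 ≤ |β - α| * (18 * β) / (1 - β) ^ 2 * B := by positivity
  calc (1 - p α β) * defectBound α β n ≤ 1 * (|β - α| * (18 * β) / (1 - β) ^ 2 * B) :=
        mul_le_mul (by linarith) h (by
          unfold defectBound smoothScale
          have := smoothBound_nonneg (α := α) (β := β) (n / 4)
          have : 0 < max α β := lt_max_of_lt_left hα.1
          positivity) zero_le_one
    _ ≤ |β - α| * (5 + 43 * β) / (1 - β) ^ 2 * B := by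
        rw [one_mul]
        gcongr
        linarith

end Main

end MarkovBinomial

open MarkovBinomial in
theorem theorem1p1 {Ω : Type*} [MeasurableSpace Ω] (μ : Measure Ω) [IsProbabilityMeasure μ]
    (α β : ℝ) (hα : α ∈ Set.Ioo (0 : ℝ) 1) (hβ : β ∈ Set.Ioo (0 : ℝ) 1)
    (n : ℕ) (hn : 1 ≤ n) (X : ℕ → Ω → Fin 2)
    (hX : IsStationaryMarkovChain μ (transitionMatrix α β) n X)
    (ES VS : ℝ) (hES : ES = ∫ ω, (chainSum n X ω : ℝ) ∂μ)
    (hVS : VS = variance (fun ω => (chainSum n X ω : ℝ)) μ) :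
    -- over-dispersed case: negative binomial approximation
    (ES < VS →
      dTV (μ.map (chainSum n X)) (negBinomial (ES ^ 2 / (VS - ES)) (ES / VS)) ≤
        C₀ α β * (2 * K₁ α β / √n + 4 * K₂ α β / n + β ^ (n / 4))) ∧
    -- boundary case, where NB(∞, 1) is the Poisson distribution with mean ES
    (VS = ES →
      dTV (μ.map (chainSum n X)) (poissonMeasure ES.toNNReal) ≤
        C₀ α β * (2 * K₁ α β / √n + 4 * K₂ α β / n + β ^ (n / 4))) ∧
    -- under-dispersed case: binomial approximation Bi(m, θ)
    (VS < ES →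
      ∀ (mt : ℝ) (m : ℕ) (θ : unitInterval),
        mt = ES ^ 2 / (ES - VS) → m = ⌊mt⌋₊ → (θ : ℝ) = n * p α β / m → (θ : ℝ) < 1 →
        dTV (μ.map (chainSum n X)) (binomial m θ) ≤
          (|p α β - θ| / (1 - θ) * C₁ α β + |β - α| / (1 - θ) * C₂ α β) *
              (2 * K₁ α β / √n + 4 * K₂ α β / n + (max β α) ^ (n / 4)) +
            (θ : ℝ) ^ 2 * (mt - m) / (n * p α β * (1 - θ))) := by
  have hp0 := p_pos hα hβ
  have hp1 := p_lt_one hα hβ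
  have hn0 : (0 : ℝ) < n := by exact_mod_cast hn
  have hmean : ES = n * p α β := hES.trans (hX.mean_variance hn hα hβ).1
  have hES0 : 0 < ES := by rw [hmean]; positivity
  refine ⟨fun hlt => ?_, fun heq => ?_, fun hlt mt m θ hmt hm hθ hθ1 => ?_⟩
  · have hab := hX.lt_of_mean_le_variance hn hα hβ (by rw [← hES, ← hVS]; exact hlt.le)
    have hVS0 : 0 < VS := hES0.trans hlt
    have hgap : 0 < VS - ES := by linarith
    have hr : 0 < ES ^ 2 / (VS - ES) := by positivity
    have hq0 : 0 < ES / VS := by positivity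
    have hq1 : ES / VS < 1 := (div_lt_one hVS0).2 hlt
    have := isProbabilityMeasure_negBinomial hr hq0 hq1
    refine (hX.dTV_le_of_birth_rates hn hα hβ (b := 1 - ES / VS) (by linarith) (by linarith)
      ?_ _ (fun k => ?_) (fun k => ?_)).trans (defectBound_le_C₀ hα hβ hn hab)
    · rw [← hmean, ← hVS]; field_simp; ring
    · rw [negBinomial_real_singleton hr hq0 hq1]; exact negBinomial_mass_pos hr hq0 hq1 k
    · rw [← negBinomial_recursion hr hq0 hq1, ← hmean]
      congr 2
      field_simp
      ring
  · have hab := hX.lt_of_mean_le_variance hn hα hβ (by rw [← hES, ← hVS]; exact heq.ge)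
    have hcoe : (ES.toNNReal : ℝ) = ES := Real.coe_toNNReal _ hES0.le
    refine (hX.dTV_le_of_birth_rates hn hα hβ (b := 0) le_rfl one_pos ?_ _ (fun k => ?_)
      (fun k => ?_)).trans (defectBound_le_C₀ hα hβ hn hab)
    · rw [← hmean, ← hVS, heq]; ring
    · exact poissonMeasure_real_singleton_pos k (Real.toNNReal_pos.2 hES0)
    · rw [← poissonMeasure_recursion, hcoe, ← hmean]; ring
  · have hgap : 0 < ES - VS := by linarith
    have hmt1 : 1 ≤ mt := by
      have := hX.mean_le_second_moment
      rw [← hES, ← hVS] at this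
      rw [hmt, le_div_iff₀ hgap]; linarith
    have hm1 : 1 ≤ m := by rw [hm]; exact Nat.le_floor (by exact_mod_cast hmt1)
    have hm0 : (0 : ℝ) < m := by exact_mod_cast hm1
    have hmle : (m : ℝ) ≤ mt := by rw [hm]; exact Nat.floor_le (by linarith)
    have hmt0 : 0 < mt := by linarith
    have hθm : n * p α β = m * θ := by rw [hθ]; field_simp
    have h := hX.dTV_binomial_le hn hα hβ hm1 θ hθm hθ1
    rw [← hVS, ← hmean] at h
    rw [← hmean] at hθ hθm ⊢
    set t : ℝ := (θ : ℝ) with ht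
    have hd : 0 < 1 - t := by linarith
    have hVSeq : VS = ES - ES ^ 2 / mt := by rw [hmt]; field_simp; ring
    -- the part of the bound that comes from rounding `mt` to an integer
    have hround : ES⁻¹ * |ES - (1 - t)⁻¹ * VS| ≤ t ^ 2 * (mt - m) / (ES * (1 - t)) := by
      have e : ES - (1 - t)⁻¹ * VS = -(ES ^ 2 * (mt - m) / (m * mt * (1 - t))) := by
        rw [hVSeq, hθ] at *
        have : (1 : ℝ) - ES / m ≠ 0 := hd.ne'
        have h' : (m : ℝ) - ES ≠ 0 := by
          intro h0
          apply this
          field_simp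
          rw [mul_zero]
          exact h0
        field_simp
        ring
      have hnn : 0 ≤ ES ^ 2 * (mt - m) / (m * mt * (1 - t)) := by
        have : 0 ≤ mt - m := by linarith
        positivity
      rw [e, abs_neg, abs_of_nonneg hnn]
      have hdiff : 0 ≤ mt - m := by linarith
      calc ES⁻¹ * (ES ^ 2 * (mt - m) / (m * mt * (1 - t)))
          ≤ ES⁻¹ * (ES ^ 2 * (mt - m) / (m * m * (1 - t))) := by gcongr
        _ = t ^ 2 * (mt - m) / (ES * (1 - t)) := by
            rw [hθ]; field_simp
    have hB := bracket_nonneg hα hβ n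
    have hdef := defectBound_le hα hβ hn
    have hM0 : 0 < max α β := lt_max_of_lt_left hα.1
    have hM1 : max α β < 1 := max_lt hα.2 hβ.2
    rw [max_comm β α]
    set B := 2 * K₁ α β / √n + 4 * K₂ α β / n + max α β ^ (n / 4) with hBdef
    have hC₁ : 0 ≤ |p α β - t| / (1 - t) * C₁ α β := by
      have : 0 < 1 - max α β := by linarith
      unfold C₁; positivity
    have hmain : (1 - t)⁻¹ * (1 - p α β) * defectBound α β n ≤ |β - α| / (1 - t) * C₂ α β * B := by
      have h1p : 0 < 1 - p α β := by linarith
      have h1M : 0 < 1 - max α β := by linarith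
      calc (1 - t)⁻¹ * (1 - p α β) * defectBound α β n
          ≤ (1 - t)⁻¹ * (1 - p α β) * (|β - α| * (18 * max α β) / (1 - max α β) ^ 2 * B) := by
            gcongr
        _ ≤ (1 - t)⁻¹ * (1 - p α β) *
            (|β - α| * (5 + 23 * max α β) / (1 - max α β) ^ 2 * B) := by
            gcongr
            linarith
        _ = |β - α| / (1 - t) * C₂ α β * B := by
            unfold C₂; field_simp
    calc _ ≤ _ := h
      _ = (1 - t)⁻¹ * (1 - p α β) * defectBound α β n + ES⁻¹ * |ES - (1 - t)⁻¹ * VS| := by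
          field_simp; ring
      _ ≤ |β - α| / (1 - t) * C₂ α β * B + t ^ 2 * (mt - m) / (ES * (1 - t)) :=
          add_le_add hmain hround
      _ ≤ _ := by
          have := mul_nonneg hC₁ hB
          linarith
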